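/- Let $k$ be an algebraically closed field of characteristic $p>0$, and let $e,f,h$ be the standard basis of $\mathfrak{sl}_2$ over $k$, with dual basis $x,y,z$. Let $\mathcal N_p=\{X\in\mathfrak{sl}_2 : X^p=0\}$ be the restricted nullcone (the cone $xy+z^2=0$), with graded coordinate ring $k[\mathcal N_p]$, and let $\mathbb P=\operatorname{Proj} k[\mathcal N_p]$. For an $\mathfrak{sl}_2$-module $M$ put $\widetilde M=\mathcal O_{\mathbb P}\otimes_k M$ and let $\Theta_M\colon\widetilde M\to\widetilde M(1)$ be the map of $\mathcal O_{\mathbb P}$-modules induced by $x\otimes e+y\otimes f+z\otimes h$. For $j\ge 0$ let $\operatorname{im}\Theta_M^j\subseteq\widetilde M$ be the image of the composite $\Theta_M(-1)\circ\cdots\circ\Theta_M(-j)\colon\widetilde M(-j)\to\widetilde M$, and for $1\le i\le p$ put \[\mathscr F_i(M)=\frac{\ker\Theta_M\cap\operatorname{im}\Theta_M^{i-1}}{\ker\Theta_M\cap\operatorname{im}\Theta_M^{i}}.\] For an integer $\lambda\ge 0$ let $V(\lambda)$ be the Weyl module with basis $v_0,\dots,v_\lambda$ and action $ev_j=(\lambda-j+1)v_{j-1}$,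 $fv_j=(j+1)v_{j+1}$, $hv_j=(\lambda-2j)v_j$ (where $v_{-1}=v_{\lambda+1}=0$). Let $B(\lambda)$ be the $(\lambda+1)\times(\lambda+1)$ matrix over $k[s,t]$, with rows and columns indexed by $0,\dots,\lambda$, whose $(i,j)$ entry is $-it^2$ if $i=j+1$, $(\lambda-2i)st$ if $i=j$, $(\lambda-i)s^2$ if $i=j-1$, and $0$ otherwise. Suppose $0\le\lambda<p$. Then for $1\le i\le p$ \[\mathscr F_i(V(\lambda))=\begin{cases}\ker\Theta_{V(\lambda)} & \text{if } i=\lambda+1,\\ 0 & \text{otherwise,}\end{cases}\] where for $i=\lambda+1$ the equality means that there is an isomorphism $\mathscr F_{\lambda+1}(V(\lambda))\cong\ker\Theta_{V(\lambda)}$ whose composite with the quotient map $\ker\Theta_{V(\lambda)}\cap\operatorname{im}\Theta_{V(\lambda)}^{\lambda}\to\mathscr F_{\lambda+1}(V(\lambda))$ is the inclusion into $\ker\Theta_{V(\lambda)}$. Moreover, $\Theta_{V(\lambda)}^{\lambda+1}=0$ (that is, $\Theta_{V(\lambda)}(m+\lambda)\circ\cdots\circ\Theta_{V(\lambda)}(m)=0$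 for every $m\in\mathbb Z$), $B(\lambda)^{\lambda+1}=0$, and the $k[s,t]$-module $\ker B(\lambda)/\operatorname{im}B(\lambda)^{\lambda}$ is finite dimensional over $k$. -/

import Mathlib

open CategoryTheory TopologicalSpace AlgebraicGeometry
universe u
noncomputable section
namespace GradedSheaf

variable {A : Type u} [CommRing A] {σ : Type*} [SetLike σ A] [AddSubgroupClass σ A]
  (𝒜 : ℕ → σ) [GradedRing 𝒜]

/-- The homogeneous pieces of a `ℤ`-graded module `N` over the graded ring `A`. -/
structure GradedPieces (N : Type u) [AddCommGroup N] [Module A N] where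
  piece : ℤ → AddSubgroup N
  smul_mem' : ∀ {i : ℕ} {j : ℤ} {a : A} {x : N}, a ∈ 𝒜 i → x ∈ piece j → a • x ∈ piece (i + j)

variable {𝒜}
variable {N : Type u} [AddCommGroup N] [Module A N] (𝒩 : GradedPieces 𝒜 N)

/-- The complement of the homogeneous prime ideal `x`. -/
abbrev primeComplAt (x : ProjectiveSpectrum 𝒜) : Submonoid A :=
  x.asHomogeneousIdeal.toIdeal.primeCompl

/-- The localization of `N` at the homogeneous prime ideal `x`. -/
abbrev StalkAt (N : Type u) [AddCommGroup N] [Module A N] (x : ProjectiveSpectrum 𝒜) : Type u :=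
  LocalizedModule (primeComplAt x) N

/-- A function on `U` with values in the localizations of `N` is a fraction of degree `n` if it is
`m / f` for homogeneous `m ∈ N`, `f ∈ A` with `deg m = deg f + n` and `f` nowhere zero on `U`. -/
def isFractionPrelocal (n : ℤ) :
    TopCat.PrelocalPredicate fun x : ProjectiveSpectrum.top 𝒜 => StalkAt N x where
  pred {U} s := ∃ (d : ℕ) (m : N) (f : A), f ∈ 𝒜 d ∧ m ∈ 𝒩.piece (d + n) ∧
    ∀ x : U, ∃ hf : f ∈ primeComplAt x.1,
      s x = LocalizedModule.mk m ⟨f, hf⟩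
  res := by
    rintro V U i s ⟨d, m, f, hf, hm, w⟩
    exact ⟨d, m, f, hf, hm, fun x => w (i x)⟩

/-- A function that is locally a fraction of degree `n`. -/
def isLocallyFraction (n : ℤ) :
    TopCat.LocalPredicate fun x : ProjectiveSpectrum.top 𝒜 => StalkAt N x :=
  (isFractionPrelocal 𝒩 n).sheafify

theorem add_mem_aux (n : ℤ) {U : Opens (ProjectiveSpectrum.top 𝒜)}
    {a b : ∀ x : U, StalkAt N x.1}
    (ha : (isLocallyFraction 𝒩 n).pred a) (hb : (isLocallyFraction 𝒩 n).pred b) :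
    (isLocallyFraction 𝒩 n).pred (a + b) := fun x => by
  obtain ⟨Va, ma, ia, da, na, fa, hfa, hna, wa⟩ := ha x
  obtain ⟨Vb, mb, ib, db, nb, fb, hfb, hnb, wb⟩ := hb x
  refine ⟨Va ⊓ Vb, ⟨ma, mb⟩, Opens.infLELeft _ _ ≫ ia, da + db, fb • na + fa • nb, fa * fb,
    SetLike.mul_mem_graded hfa hfb, ?_, fun y ↦ ?_⟩
  · have h1 := 𝒩.smul_mem' hfb hna
    have h2 := 𝒩.smul_mem' hfa hnb
    rw [show ((da + db : ℕ) : ℤ) + n = db + (da + n) by push_cast; ring]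
    rw [show (da : ℤ) + (db + n) = db + (da + n) by ring] at h2
    exact add_mem h1 h2
  · obtain ⟨hsax, hsa⟩ := wa ⟨y.1, y.2.1⟩
    obtain ⟨hsbx, hsb⟩ := wb ⟨y.1, y.2.2⟩
    exact ⟨mul_mem hsax hsbx, congr($hsa + $hsb).trans (LocalizedModule.mk_add_mk ..)⟩

theorem smul_mem_aux (n : ℤ) (U : (Opens (ProjectiveSpectrum.top 𝒜))ᵒᵖ)
    (r : (ProjectiveSpectrum.Proj.structureSheaf 𝒜).1.obj U)
    {a : ∀ x : U.unop, StalkAt N x.1}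
    (ha : (isLocallyFraction 𝒩 n).pred a) :
    (isLocallyFraction 𝒩 n).pred (fun x : U.unop => (r.1 x).val • a x) := fun x => by
  obtain ⟨Vr, mr, ir, dr, ⟨p, hp⟩, ⟨q, hq⟩, nin, wr⟩ := r.2 x
  obtain ⟨Va, ma, ia, da, na, fa, hfa, hna, wa⟩ := ha x
  refine ⟨Vr ⊓ Va, ⟨mr, ma⟩, Opens.infLELeft _ _ ≫ ir, dr + da, p • na, q * fa,
    SetLike.mul_mem_graded hq hfa, ?_, fun y ↦ ?_⟩
  · rw [show ((dr + da : ℕ) : ℤ) + n = dr + (da + n) by push_cast; ring]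
    exact 𝒩.smul_mem' hp hna
  · have hr := wr ⟨y.1, y.2.1⟩
    have hry := nin ⟨y.1, y.2.1⟩
    obtain ⟨hsbx, hsb⟩ := wa ⟨y.1, y.2.2⟩
    refine ⟨(primeComplAt y.1).mul_mem hry hsbx, ?_⟩
    have := congr(HomogeneousLocalization.val $hr • $hsb)
    rw [HomogeneousLocalization.val_mk, LocalizedModule.mk_smul_mk] at this
    exact this

/-- The sections over `U` of the sheaf associated to `N` with degrees shifted by `n`. -/
def sections (n : ℤ) (U : Opens (ProjectiveSpectrum.top 𝒜)) :
    AddSubgroup (∀ x : U, StalkAt N x.1) where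
  carrier := {s | (isLocallyFraction 𝒩 n).pred s}
  zero_mem' := fun x => ⟨U, x.2, 𝟙 _, 0, 0, 1, SetLike.GradedOne.one_mem, zero_mem _, fun y =>
    ⟨(primeComplAt y.1).one_mem, (LocalizedModule.zero_mk _).symm⟩⟩
  add_mem' := add_mem_aux 𝒩 n
  neg_mem' := by
    intro a ha x
    obtain ⟨V, m, i, d, y, f, hf, hy, w⟩ := ha x
    refine ⟨V, m, i, d, -y, f, hf, neg_mem hy, fun z => ?_⟩
    obtain ⟨h1, h2⟩ := w z
    exact ⟨h1, congr(-$h2).trans (LocalizedModule.mk_neg ..).symm⟩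

/-- The sheaf associated to `N` with degrees shifted by `n`, as a sheaf of sets. -/
def sheafInType (n : ℤ) : TopCat.Sheaf (Type u) (ProjectiveSpectrum.top 𝒜) :=
  TopCat.subsheafToTypes (isLocallyFraction 𝒩 n)

/-- The sheaf associated to `N` with degrees shifted by `n`, as a presheaf of abelian groups. -/
def abPresheaf (n : ℤ) : TopCat.Presheaf Ab (ProjectiveSpectrum.top 𝒜) where
  obj U := AddCommGrpCat.of (sections 𝒩 n U.unop)
  map i := AddCommGrpCat.ofHom
    { toFun := (sheafInType 𝒩 n).1.map i
      map_zero' := rfl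
      map_add' := fun _ _ => rfl }

/-- Sections of the structure sheaf act pointwise. -/
instance sectionsModule (n : ℤ) (U : (Opens (ProjectiveSpectrum.top 𝒜))ᵒᵖ) :
    Module ((ProjectiveSpectrum.Proj.structureSheaf 𝒜).1.obj U) (sections 𝒩 n U.unop) where
  smul a s := ⟨fun x => (a.1 x).val • s.1 x, smul_mem_aux 𝒩 n U a s.2⟩
  one_smul s := Subtype.ext <| funext fun x => by
    change HomogeneousLocalization.val 1 • s.1 x = s.1 x
    rw [HomogeneousLocalization.val_one, one_smul]
  mul_smul a b s := Subtype.ext <| funext fun x => by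
    change HomogeneousLocalization.val (a.1 x * b.1 x) • s.1 x =
      (a.1 x).val • (b.1 x).val • s.1 x
    rw [HomogeneousLocalization.val_mul, mul_smul]
  smul_zero a := Subtype.ext <| funext fun x => smul_zero (a.1 x).val
  smul_add a s t := Subtype.ext <| funext fun x => smul_add (a.1 x).val (s.1 x) (t.1 x)
  add_smul a b s := Subtype.ext <| funext fun x => by
    change HomogeneousLocalization.val (a.1 x + b.1 x) • s.1 x =
      (a.1 x).val • s.1 x + (b.1 x).val • s.1 x
    rw [HomogeneousLocalization.val_add, add_smul]
  zero_smul s := Subtype.ext <| funext fun x => by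
    change HomogeneousLocalization.val 0 • s.1 x = 0
    rw [HomogeneousLocalization.val_zero, zero_smul]

/-- The sheaf associated to `N` with degrees shifted by `n`, as a presheaf of modules. -/
def presheafOfModules (n : ℤ) : (Proj 𝒜).PresheafOfModules :=
  letI _inst (U : (Opens (Proj 𝒜))ᵒᵖ) :
      Module ((Proj 𝒜).ringCatSheaf.obj.obj U) ((abPresheaf 𝒩 n).obj U) :=
    sectionsModule 𝒩 n U
  PresheafOfModules.ofPresheaf (R := (Proj 𝒜).ringCatSheaf.obj) (abPresheaf 𝒩 n)
    fun _ _ _ _ _ ↦ rfl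

/-- The `𝒪`-module on `Proj A` associated to the graded module `N` with degrees shifted by `n`, that
is, to the graded module whose piece of degree `d` is the piece of `N` of degree `d + n`. -/
def sheaf (n : ℤ) : (Proj 𝒜).Modules where
  val := presheafOfModules 𝒩 n
  isSheaf := (TopCat.Presheaf.isSheaf_iff_isSheaf_comp (forget AddCommGrpCat) _).2
    (sheafInType 𝒩 n).2


variable {N' : Type u} [AddCommGroup N'] [Module A N'] {𝒩' : GradedPieces 𝒜 N'} {𝒩}

/-- The `A`-linear map `φ` raises degrees by `d`. -/
def IsHomogeneousOfDegree (𝒩 : GradedPieces 𝒜 N) (𝒩' : GradedPieces 𝒜 N')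
    (φ : N →ₗ[A] N') (d : ℤ) : Prop :=
  ∀ (j : ℤ) (x : N), x ∈ 𝒩.piece j → φ x ∈ 𝒩'.piece (j + d)

/-- The map induced by `φ` on the localizations at `x`. -/
def stalkMap (φ : N →ₗ[A] N') (x : ProjectiveSpectrum 𝒜) :
   StalkAt N x →ₗ[Localization (primeComplAt x)] StalkAt N' x :=
  LocalizedModule.map (primeComplAt x) φ

theorem map_mem_aux {φ : N →ₗ[A] N'} {d : ℤ} (hφ : IsHomogeneousOfDegree 𝒩 𝒩' φ d)
    {n n' : ℤ} (h : n + d = n') {U : Opens (ProjectiveSpectrum.top 𝒜)}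
    {a : ∀ x : U, StalkAt N x.1}
    (ha : (isLocallyFraction 𝒩 n).pred a) :
    (isLocallyFraction 𝒩' n').pred (fun x : U => stalkMap φ x.1 (a x)) := fun x => by
  obtain ⟨V, m, i, e, y, f, hf, hy, w⟩ := ha x
  refine ⟨V, m, i, e, φ y, f, hf, ?_, fun z => ?_⟩
  · rw [← h, ← add_assoc]
    exact hφ _ _ hy
  · obtain ⟨h1, h2⟩ := w z
    exact ⟨h1, congr(stalkMap φ z.1 $h2).trans (LocalizedModule.map_mk ..)⟩

/-- The map of presheaves of modules induced by a map that raises degrees by `d`. -/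
def presheafMap {φ : N →ₗ[A] N'} {d : ℤ} (hφ : IsHomogeneousOfDegree 𝒩 𝒩' φ d)
    {n n' : ℤ} (h : n + d = n') : presheafOfModules 𝒩 n ⟶ presheafOfModules 𝒩' n' :=
  PresheafOfModules.homMk (M₁ := presheafOfModules 𝒩 n) (M₂ := presheafOfModules 𝒩' n')
    { app _ := AddCommGrpCat.ofHom
        { toFun s := ⟨fun x => stalkMap φ x.1 (s.1 x), map_mem_aux hφ h s.2⟩
          map_zero' := Subtype.ext <| funext fun x => map_zero (stalkMap φ x.1)
          map_add' s t := Subtype.ext <| funext fun x => map_add (stalkMap φ x.1) (s.1 x) (t.1 x) }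
      naturality _ _ _ := rfl }
    fun _ r s => Subtype.ext <| funext fun x =>
      map_smul (stalkMap φ x.1) (HomogeneousLocalization.val (r.1 x)) (s.1 x)

/-- The map of sheaves of modules induced by a map that raises degrees by `d`. -/
def sheafMap {φ : N →ₗ[A] N'} {d : ℤ} (hφ : IsHomogeneousOfDegree 𝒩 𝒩' φ d)
    {n n' : ℤ} (h : n + d = n') : sheaf 𝒩 n ⟶ sheaf 𝒩' n' :=
  ⟨presheafMap hφ h⟩

end GradedSheaf

namespace QuotientGrading

open DirectSum

variable {k R : Type*} [Field k] [CommRing R] [Algebra k R] (ℛ : ℕ → Submodule k R)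
  [GradedAlgebra ℛ] (I : Ideal R)

/-- The images in `R ⧸ I` of the graded pieces of `R`. -/
def piece (n : ℕ) : Submodule k (R ⧸ I) :=
  (ℛ n).map (Ideal.Quotient.mkₐ k I).toLinearMap

/-- The projection of a graded piece of `R` onto its image in `R ⧸ I`. -/
def toPiece (n : ℕ) : ℛ n →ₗ[k] piece ℛ I n :=
  (Ideal.Quotient.mkₐ k I).toLinearMap.restrict fun _ hx => Submodule.mem_map_of_mem hx

variable {I}

/-- The decomposition of an element of `R ⧸ I` into homogeneous components. -/
def decomposeAux (hI : I.IsHomogeneous ℛ) : (R ⧸ I) →+ ⨁ n, piece ℛ I n :=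
  QuotientAddGroup.lift (Submodule.toAddSubgroup I)
    ((DirectSum.lmap (toPiece ℛ I)).toAddMonoidHom.comp (decomposeAddEquiv ℛ).toAddMonoidHom)
    fun x hx => by
      have h : DirectSum.lmap (toPiece ℛ I) (decompose ℛ x) = 0 := by
        refine DFinsupp.ext fun n => Subtype.ext ?_
        exact Ideal.Quotient.eq_zero_iff_mem.mpr (hI n hx)
      exact h

theorem decomposeAux_mk (hI : I.IsHomogeneous ℛ) (x : R) :
    decomposeAux ℛ hI (Ideal.Quotient.mk I x) = DirectSum.lmap (toPiece ℛ I) (decompose ℛ x) := rfl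

/-- The grading of the quotient of a graded algebra by a homogeneous ideal. -/
@[reducible]
def gradedAlgebra (hI : I.IsHomogeneous ℛ) : GradedAlgebra (piece ℛ I) where
  one_mem := ⟨1, SetLike.GradedOne.one_mem, map_one (Ideal.Quotient.mkₐ k I)⟩
  mul_mem := by
    rintro i j _ _ ⟨x, hx, rfl⟩ ⟨y, hy, rfl⟩
    exact ⟨x * y, SetLike.mul_mem_graded hx hy, map_mul (Ideal.Quotient.mkₐ k I) _ _⟩
  decompose' := decomposeAux ℛ hI
  left_inv := by
    intro x
    obtain ⟨x, rfl⟩ := Ideal.Quotient.mk_surjective x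
    rw [decomposeAux_mk]
    induction x using DirectSum.Decomposition.inductionOn ℛ with
    | zero => simp
    | homogeneous m =>
      rw [decompose_coe, DirectSum.lmap_of, DirectSum.coeAddMonoidHom_of]; rfl
    | add m m' h h' => rw [decompose_add, map_add, map_add, h, h', map_add]
  right_inv := by
    intro x
    induction x using DirectSum.induction_on with
    | zero => simp
    | of i x =>
      obtain ⟨_, x, hx, rfl⟩ := x
      rw [DirectSum.coeAddMonoidHom_of]
      refine (decomposeAux_mk ℛ hI x).trans ?_
      rw [decompose_of_mem ℛ hx, DirectSum.lmap_of]; rfl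
    | add x y h h' => rw [map_add, map_add, h, h']

end QuotientGrading

namespace SlTwo

open MvPolynomial TensorProduct

/-- The Lie algebra `𝔰𝔩₂` over `k`. -/
abbrev Sl (k : Type u) [Field k] := LieAlgebra.SpecialLinear.sl (Fin 2) k

section Nullcone

variable (p : ℕ) (k : Type u) [Field k]

/-- The restricted nullcone: the `p`-operation of `𝔰𝔩₂` is the `p`-th power of matrices. -/
def nullcone : Set (Sl k) := {X | (X : Matrix (Fin 2) (Fin 2) k) ^ p = 0}

variable {k} in
/-- The coordinates `(x, y, z)` dual to the basis `e, f, h`. -/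
def coords (X : Sl k) : Fin 3 → k :=
  ![(X : Matrix (Fin 2) (Fin 2) k) 0 1, (X : Matrix (Fin 2) (Fin 2) k) 1 0,
    (X : Matrix (Fin 2) (Fin 2) k) 0 0]

/-- The ideal of polynomial functions in `x, y, z` that vanish on the restricted nullcone. -/
def nullconeIdeal : Ideal (MvPolynomial (Fin 3) k) :=
  MvPolynomial.vanishingIdeal k (coords '' nullcone p k)

/-- The coordinate ring of the restricted nullcone. -/
abbrev CoordRing : Type u := MvPolynomial (Fin 3) k ⧸ nullconeIdeal p k

attribute [local instance] MvPolynomial.gradedAlgebra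

theorem smul_mem_nullcone {X : Sl k} (hX : X ∈ nullcone p k) (c : k) : c • X ∈ nullcone p k := by
  have : (X : Matrix (Fin 2) (Fin 2) k) ^ p = 0 := hX
  change (c • (X : Matrix (Fin 2) (Fin 2) k)) ^ p = 0
  rw [smul_pow, this, smul_zero]

theorem coords_smul (c : k) (X : Sl k) : coords (c • X) = c • coords X := by
  funext i; fin_cases i <;> rfl

variable {k} in
theorem aeval_smul_of_isHomogeneous {n : ℕ} {G : MvPolynomial (Fin 3) k} (hG : G.IsHomogeneous n)
    (c : k) (v : Fin 3 → k) : aeval (c • v) G = aeval v G * c ^ n := by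
  rw [aeval_def, aeval_def, eval₂_eq', eval₂_eq', Finset.sum_mul]
  refine Finset.sum_congr rfl fun d hd => ?_
  have h1 : ∑ i, d i = n := by
    rw [← hG (mem_support_iff.mp hd), Finsupp.weight_apply, Finsupp.sum_fintype _ _ (by simp)]
    simp
  simp only [Pi.smul_apply, smul_eq_mul, mul_pow, Finset.prod_mul_distrib,
    Finset.prod_pow_eq_pow_sum, h1]
  ring

theorem nullconeIdeal_isHomogeneous [Infinite k] :
    (nullconeIdeal p k).IsHomogeneous (homogeneousSubmodule (Fin 3) k) := by
  intro n F hF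
  rw [show (DirectSum.decompose (homogeneousSubmodule (Fin 3) k) F n : MvPolynomial (Fin 3) k) =
    homogeneousComponent n F from decomposition.decompose'_apply F n]
  rintro _ ⟨X, hX, rfl⟩
  let P : Polynomial k := ∑ i ∈ Finset.range (F.totalDegree + 1),
    Polynomial.C (aeval (coords X) (homogeneousComponent i F)) * Polynomial.X ^ i
  have hP : P = 0 := by
    refine Polynomial.funext fun c => ?_
    have h0 : aeval (coords (c • X)) F = 0 := hF _ ⟨_, smul_mem_nullcone p k hX c, rfl⟩
    rw [← sum_homogeneousComponent F, map_sum] at h0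
    rw [Polynomial.eval_zero, ← h0, Polynomial.eval_finsetSum]
    refine Finset.sum_congr rfl fun i _ => ?_
    rw [Polynomial.eval_mul, Polynomial.eval_C, Polynomial.eval_pow, Polynomial.eval_X, coords_smul]
    exact (aeval_smul_of_isHomogeneous (homogeneousComponent_isHomogeneous i F) c _).symm
  by_cases hn : n ∈ Finset.range (F.totalDegree + 1)
  · have := congr(Polynomial.coeff $hP n)
    simpa [P, Polynomial.finsetSum_coeff, Polynomial.coeff_C_mul, Polynomial.coeff_X_pow, hn] using this
  · rw [homogeneousComponent_eq_zero _ _ (by simpa using hn), map_zero]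

/-- The grading of the coordinate ring of the restricted nullcone by degree. -/
abbrev coordGrading (n : ℕ) : Submodule k (CoordRing p k) :=
  QuotientGrading.piece (homogeneousSubmodule (Fin 3) k) (nullconeIdeal p k) n

instance [Infinite k] : GradedAlgebra (coordGrading p k) :=
  QuotientGrading.gradedAlgebra _ (nullconeIdeal_isHomogeneous p k)

/-- The projectivization of the restricted nullcone. -/
abbrev ProjNullcone [Infinite k] : Scheme.{u} := Proj (coordGrading p k)

end Nullcone

section GlobalOperator

variable (p : ℕ) (k : Type u) [Field k]
  (M : Type u) [AddCommGroup M] [Module k M] [LieRingModule (Sl k) M] [LieModule k (Sl k) M]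

/-- The standard basis element `e` of `𝔰𝔩₂`. -/
def slE : Sl k := LieAlgebra.SpecialLinear.single 0 1 (by decide) 1

/-- The standard basis element `f` of `𝔰𝔩₂`. -/
def slF : Sl k := LieAlgebra.SpecialLinear.single 1 0 (by decide) 1

/-- The standard basis element `h` of `𝔰𝔩₂`. -/
def slH : Sl k := LieAlgebra.SpecialLinear.singleSubSingle 0 1 1

/-- The coordinate functions `x, y, z` on the restricted nullcone. -/
def coordFun (i : Fin 3) : CoordRing p k := Ideal.Quotient.mk (nullconeIdeal p k) (X i)

theorem coordFun_mem (i : Fin 3) : coordFun p k i ∈ coordGrading p k 1 :=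
  ⟨X i, isHomogeneous_X k i, rfl⟩

/-- The operator `Θ = x ⊗ e + y ⊗ f + z ⊗ h` on `k[𝒩] ⊗ M`. -/
def theta : CoordRing p k ⊗[k] M →ₗ[CoordRing p k] CoordRing p k ⊗[k] M :=
  coordFun p k 0 • (LieModule.toEnd k (Sl k) M (slE k)).baseChange (CoordRing p k) +
  coordFun p k 1 • (LieModule.toEnd k (Sl k) M (slF k)).baseChange (CoordRing p k) +
  coordFun p k 2 • (LieModule.toEnd k (Sl k) M (slH k)).baseChange (CoordRing p k)

theorem theta_tmul (a : CoordRing p k) (v : M) :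
    theta p k M (a ⊗ₜ v) = (coordFun p k 0 * a) ⊗ₜ ⁅slE k, v⁆ + (coordFun p k 1 * a) ⊗ₜ ⁅slF k, v⁆ +
      (coordFun p k 2 * a) ⊗ₜ ⁅slH k, v⁆ := rfl

variable [Infinite k]

/-- The graded `k[𝒩]`-module `k[𝒩] ⊗ M`, where `M` is placed in degree `0`. -/
def freePieces : GradedSheaf.GradedPieces (coordGrading p k) (CoordRing p k ⊗[k] M) where
  piece j := AddSubgroup.closure
    {w | ∃ (d : ℕ) (a : CoordRing p k) (v : M), (d : ℤ) = j ∧ a ∈ coordGrading p k d ∧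
      w = a ⊗ₜ[k] v}
  smul_mem' := by
    intro i j a w ha hw
    induction hw using AddSubgroup.closure_induction with
    | mem w hw =>
      obtain ⟨d, b, v, rfl, hb, rfl⟩ := hw
      refine AddSubgroup.subset_closure ⟨i + d, a * b, v, by push_cast; rfl,
        SetLike.mul_mem_graded ha hb, rfl⟩
    | zero => rw [smul_zero]; exact zero_mem _
    | add x y _ _ hx hy => rw [smul_add]; exact add_mem hx hy
    | neg x _ hx => rw [smul_neg]; exact neg_mem hx

theorem theta_isHomogeneous :
    GradedSheaf.IsHomogeneousOfDegree (freePieces p k M) (freePieces p k M) (theta p k M) 1 := by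
  intro j w hw
  induction hw using AddSubgroup.closure_induction with
  | mem w hw =>
    obtain ⟨d, b, v, rfl, hb, rfl⟩ := hw
    have key : ∀ (i : Fin 3) (v' : M), (coordFun p k i * b) ⊗ₜ v' ∈
        (freePieces p k M).piece ((d : ℤ) + 1) := fun i v' =>
      AddSubgroup.subset_closure ⟨1 + d, _, v', by push_cast; ring,
        SetLike.mul_mem_graded (coordFun_mem p k i) hb, rfl⟩
    rw [theta_tmul]
    exact add_mem (add_mem (key _ _) (key _ _)) (key _ _)
  | zero => rw [map_zero]; exact zero_mem _
  | add x y _ _ hx hy => rw [map_add]; exact add_mem hx hy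
  | neg x _ hx => rw [map_neg]; exact neg_mem hx

/-- The sheaf `M̃(n) = 𝒪(n) ⊗ M` on the projectivized restricted nullcone, as the sheaf associated
to the graded module `k[𝒩] ⊗ M` with its degrees shifted by `n`. -/
def tildeTwist (n : ℤ) : (ProjNullcone p k).Modules :=
  GradedSheaf.sheaf (freePieces p k M) n

/-- The twist `Θ_M(m) : M̃(m) ⟶ M̃(m + 1)` of the global operator. -/
def globalOp (m n : ℤ) (h : m + 1 = n) : tildeTwist p k M m ⟶ tildeTwist p k M n :=
  GradedSheaf.sheafMap (theta_isHomogeneous p k M) h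

/-- The composite `Θ_M(m + j - 1) ∘ ⋯ ∘ Θ_M(m + 1) ∘ Θ_M(m) : M̃(m) ⟶ M̃(m + j)`. -/
def globalOpPow : (j : ℕ) → (m n : ℤ) → m + j = n → (tildeTwist p k M m ⟶ tildeTwist p k M n)
  | 0, _, _, h => eqToHom (congrArg (tildeTwist p k M) (by simpa using h))
  | j + 1, m, n, h =>
    globalOp p k M m (m + 1) rfl ≫ globalOpPow j (m + 1) n (by rw [← h]; push_cast; ring)

/-- The kernel of `Θ_M(j - 1) ∘ ⋯ ∘ Θ_M(1) ∘ Θ_M`, a subsheaf of `M̃`. -/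
def kerSub (j : ℕ) : Subobject (tildeTwist p k M 0) :=
  Limits.kernelSubobject (globalOpPow p k M j 0 j (zero_add _))

/-- The image of `Θ_M(-1) ∘ Θ_M(-2) ∘ ⋯ ∘ Θ_M(-j) : M̃(-j) ⟶ M̃`, a subsheaf of `M̃`. -/
def imSub (j : ℕ) : Subobject (tildeTwist p k M 0) :=
  Limits.imageSubobject (globalOpPow p k M j (-j) 0 (neg_add_cancel _))

theorem imSub_succ_le (j : ℕ) : imSub p k M (j + 1) ≤ imSub p k M j := by
  have key : ∀ (m m' : ℤ) (h : m + ((j + 1 : ℕ) : ℤ) = 0) (h' : m' + (j : ℤ) = 0),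
      Limits.imageSubobject (globalOpPow p k M (j + 1) m 0 h) ≤
        Limits.imageSubobject (globalOpPow p k M j m' 0 h') := by
    intro m m' h h'
    obtain rfl : m' = m + 1 := by push_cast at h; linarith
    exact Limits.imageSubobject_comp_le _ _
  exact key _ _ _ _

theorem imSub_le_pred (i : ℕ) : imSub p k M i ≤ imSub p k M (i - 1) := by
  cases i with
  | zero => exact le_rfl
  | succ j => exact imSub_succ_le p k M j

/-- The sheaf `ℱ_i(M) = (ker Θ_M ∩ im Θ_M^{i-1}) / (ker Θ_M ∩ im Θ_M^i)`, for `i ≥ 1`. -/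
def sheafF (i : ℕ) : (ProjNullcone p k).Modules :=
  Limits.cokernel (Subobject.ofLE (kerSub p k M 1 ⊓ imSub p k M i)
    (kerSub p k M 1 ⊓ imSub p k M (i - 1)) (inf_le_inf_left _ (imSub_le_pred p k M i)))

/-- The quotient map `ker Θ_M ∩ im Θ_M^{i-1} ⟶ ℱ_i(M)`. -/
def sheafFπ (i : ℕ) : ((kerSub p k M 1 ⊓ imSub p k M (i - 1) : Subobject _) :
    (ProjNullcone p k).Modules) ⟶ sheafF p k M i :=
  Limits.cokernel.π _

end GlobalOperator

section Weyl

variable (k : Type u) [Field k] (l : ℕ)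

/-- The matrix of `e` on `V(λ)`: `e v_j = (λ - j + 1) v_{j-1}`. -/
def weylE : Matrix (Fin (l + 1)) (Fin (l + 1)) k :=
  Matrix.of fun i j => if (j : ℕ) = i + 1 then (l : k) - (j : ℕ) + 1 else 0

/-- The matrix of `f` on `V(λ)`: `f v_j = (j + 1) v_{j+1}`. -/
def weylF : Matrix (Fin (l + 1)) (Fin (l + 1)) k :=
  Matrix.of fun i j => if (i : ℕ) = j + 1 then ((j : ℕ) : k) + 1 else 0

/-- The matrix of `h` on `V(λ)`: `h v_j = (λ - 2j) v_j`. -/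
def weylH : Matrix (Fin (l + 1)) (Fin (l + 1)) k :=
  Matrix.diagonal fun j => (l : k) - 2 * (j : ℕ)

theorem weyl_EF : weylE k l * weylF k l - weylF k l * weylE k l = weylH k l := by
  have h1 : ∀ i j : Fin (l + 1), (weylE k l * weylF k l) i j =
      if i = j then ((l : k) - (i : ℕ)) * ((i : ℕ) + 1) else 0 := by
    rintro ⟨i, hi⟩ ⟨j, hj⟩
    simp only [weylE, weylF, Matrix.mul_apply, Matrix.of_apply, Fin.mk.injEq]
    rw [Fin.sum_univ_eq_sum_range (fun m => (if m = i + 1 then (l : k) - m + 1 else 0) *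
      (if m = j + 1 then (j : k) + 1 else 0)) (l + 1)]
    simp only [ite_mul, zero_mul, Finset.sum_ite_eq', Finset.mem_range]
    split_ifs with h2 h3 h4 h5 h6
    · obtain rfl : i = j := by omega
      push_cast; ring
    · omega
    · omega
    · simp
    · obtain rfl : i = l := by omega
      simp
    · rfl
  have h2 : ∀ i j : Fin (l + 1), (weylF k l * weylE k l) i j =
      if i = j then ((i : ℕ) : k) * ((l : k) - (i : ℕ) + 1) else 0 := by
    rintro ⟨i, hi⟩ ⟨j, hj⟩
    simp only [weylE, weylF, Matrix.mul_apply, Matrix.of_apply, Fin.mk.injEq]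
    rw [Fin.sum_univ_eq_sum_range (fun m => (if i = m + 1 then (m : k) + 1 else 0) *
      (if j = m + 1 then (l : k) - j + 1 else 0)) (l + 1)]
    cases i with
    | zero => simp
    | succ i =>
      simp only [ite_mul, zero_mul, Nat.add_right_cancel_iff, Finset.sum_ite_eq, Finset.mem_range]
      split_ifs with h3 h4 h5 h6 h7
      · subst h4; push_cast; ring
      · omega
      · omega
      · simp
      · omega
      · rfl
  ext i j
  rw [Matrix.sub_apply, h1, h2, weylH, Matrix.diagonal_apply]
  split_ifs with h
  · ring
  · simp

theorem weyl_HE : weylH k l * weylE k l - weylE k l * weylH k l = 2 • weylE k l := by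
  ext i j
  simp only [weylE, weylH, Matrix.sub_apply, Matrix.diagonal_mul, Matrix.mul_diagonal,
    Matrix.of_apply, Matrix.smul_apply]
  split_ifs with h
  · rw [h]; push_cast; simp only [nsmul_eq_mul]; push_cast; ring
  · simp

theorem weyl_HF : weylH k l * weylF k l - weylF k l * weylH k l = -(2 • weylF k l) := by
  ext i j
  simp only [weylF, weylH, Matrix.sub_apply, Matrix.diagonal_mul, Matrix.mul_diagonal,
    Matrix.of_apply, Matrix.smul_apply, Matrix.neg_apply]
  split_ifs with h
  · rw [h]; push_cast; simp only [nsmul_eq_mul]; push_cast; ring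
  · simp

variable {k} in
/-- The matrix by which `X = x e + y f + z h` acts on `V(λ)`. -/
def weylMatrix (X : Sl k) : Matrix (Fin (l + 1)) (Fin (l + 1)) k :=
  X.1 0 1 • weylE k l + X.1 1 0 • weylF k l + X.1 0 0 • weylH k l

theorem weylMatrix_lie (X Y : Sl k) : weylMatrix l ⁅X, Y⁆ =
    weylMatrix l X * weylMatrix l Y - weylMatrix l Y * weylMatrix l X := by
  have tr : ∀ Z : Sl k, Z.1 1 1 = -Z.1 0 0 := fun Z => by
    have h : Matrix.trace Z.1 = 0 := Z.2
    rw [Matrix.trace_fin_two] at h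
    exact eq_neg_of_add_eq_zero_right h
  have hEF := sub_eq_iff_eq_add.mp (weyl_EF k l)
  have hHE := sub_eq_iff_eq_add.mp (weyl_HE k l)
  have hHF := sub_eq_iff_eq_add.mp (weyl_HF k l)
  simp only [weylMatrix, LieAlgebra.SpecialLinear.sl_bracket, Matrix.sub_apply, Matrix.mul_apply,
    Fin.sum_univ_two, tr, add_mul, mul_add, smul_mul_assoc, mul_smul_comm, hEF, hHE, hHF]
  module

theorem weylMatrix_add (X Y : Sl k) : weylMatrix l (X + Y) = weylMatrix l X + weylMatrix l Y := by
  change (X.1 + Y.1) 0 1 • _ + (X.1 + Y.1) 1 0 • _ + (X.1 + Y.1) 0 0 • _ = _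
  simp only [Matrix.add_apply, weylMatrix]
  module

theorem weylMatrix_smul (c : k) (X : Sl k) : weylMatrix l (c • X) = c • weylMatrix l X := by
  change (c • X.1) 0 1 • _ + (c • X.1) 1 0 • _ + (c • X.1) 0 0 • _ = _
  simp only [Matrix.smul_apply, weylMatrix]
  module

theorem weylMatrix_leibniz (X Y : Sl k) (v : Fin (l + 1) → k) :
    (weylMatrix l X).mulVec ((weylMatrix l Y).mulVec v) =
      (weylMatrix l ⁅X, Y⁆).mulVec v + (weylMatrix l Y).mulVec ((weylMatrix l X).mulVec v) := by
  rw [weylMatrix_lie, Matrix.sub_mulVec, Matrix.mulVec_mulVec, Matrix.mulVec_mulVec,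
    sub_add_cancel]

/-- The Weyl module `V(λ)`; its elements are the coordinate vectors with respect to the basis
`v_0, …, v_λ`. -/
def WeylModule : Type u := Fin (l + 1) → k

instance : AddCommGroup (WeylModule k l) := inferInstanceAs (AddCommGroup (Fin (l + 1) → k))

instance : Module k (WeylModule k l) := inferInstanceAs (Module k (Fin (l + 1) → k))

instance : LieRingModule (Sl k) (WeylModule k l) where
  bracket X v := (weylMatrix l X).mulVec v
  add_lie X Y v := (congrArg (fun B => Matrix.mulVec B v) (weylMatrix_add k l X Y)).trans
    (Matrix.add_mulVec (weylMatrix l X) (weylMatrix l Y) v)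
  lie_add X v w := Matrix.mulVec_add (weylMatrix l X) v w
  leibniz_lie X Y v := weylMatrix_leibniz k l X Y v

instance : LieModule k (Sl k) (WeylModule k l) where
  smul_lie c X v := (congrArg (fun B => Matrix.mulVec B v) (weylMatrix_smul k l c X)).trans
    (Matrix.smul_mulVec c (weylMatrix l X) v)
  lie_smul c X v := Matrix.mulVec_smul (weylMatrix l X) c v

/-- The matrix `B(λ)` over `k[s, t]` (with `s = X 0`, `t = X 1`) by which the operator
`s² e - t² f + s t h` acts on `k[s, t] ⊗ V(λ)`. -/
def matB : Matrix (Fin (l + 1)) (Fin (l + 1)) (MvPolynomial (Fin 2) k) :=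
  Matrix.of fun i j =>
    if (i : ℕ) = j + 1 then -((i : ℕ) : MvPolynomial (Fin 2) k) * X 1 ^ 2
    else if i = j then ((l : MvPolynomial (Fin 2) k) - 2 * ((i : ℕ) : MvPolynomial (Fin 2) k)) * (X 0 * X 1)
    else if (j : ℕ) = i + 1 then ((l : MvPolynomial (Fin 2) k) - ((i : ℕ) : MvPolynomial (Fin 2) k)) * X 0 ^ 2
    else 0

end Weyl
end SlTwo
end

/-!
The argument is that `Θ` on the Weyl module behaves, near every point of the projectivized nullcone,
like a single nilpotent Jordan block of size `l + 1`.

In coordinates `Θ` is the tridiagonal matrix `thetaMatrix l x y z`, and `B(l)` is the same matrix at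
`(s², -t², st)`; both satisfy `x y + z² = 0`. Over any commutative ring the transpose of this matrix
acts on the binary forms of degree `l` through the vector field
`x b ∂/∂a + y a ∂/∂b + z (a ∂/∂a - b ∂/∂b)`, and `x y + z² = 0` says that the square of this field
kills `a` and `b`. By the Leibniz rule its `(l + 1)`-st power kills every form of degree `l`, so the
`(l + 1)`-st power of the matrix vanishes (`thetaMatrix_pow_eq_zero`).

The superdiagonal entries of the matrix are the multiples `(l - i) x`, with `l - i` invertible
because `l < p`. Hence, where `x` is invertible, a vector in the kernel is determined by its first
coordinate. The last column of the `l`-th power lies in the kernel and has first coordinate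
`l! x ^ l`, so it generates the kernel, and the kernel is the image of the `l`-th power. Reversing
the basis exchanges `x` with `y`. This is stated without inverting anything, as an identity up to a
power of `x` or `y` (`exists_pow_smul_sub_thetaMatrix_pow_eq_zero`).

For `B(l)` it follows that `ker B(l) / im B(l) ^ l` is killed by powers of `s` and of `t`, and being
finitely generated it is finite dimensional (`finite_ker_matB_quotient`). On the projectivized
nullcone `x` and `y` have no common zero, so sections of `ker Θ` lift locally along `Θ ^ l`
(`exists_local_lift`), which gives `ker Θ ≤ im Θ ^ l` (`kerSub_one_le_imSub`). Together with
`Θ ^ (l + 1) = 0` this shows that `ker Θ ∩ im Θ ^ i` is `ker Θ` for `i ≤ l` and `0` for `i > l`.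
-/

noncomputable section

/-! ### Generalities on subobjects, sheaves of modules and localizations -/

theorem CategoryTheory.Subobject.isZero_of_le_bot {C : Type*} [Category* C]
    [Limits.HasZeroMorphisms C] [Limits.HasZeroObject C] {X : C} {S : Subobject X} (h : S ≤ ⊥) :
    Limits.IsZero (S : C) := by
  obtain rfl := le_bot_iff.mp h
  exact (Limits.isZero_zero C).of_iso Subobject.botCoeIsoZero

theorem CategoryTheory.Subobject.isIso_ofLE_of_ge {C : Type*} [Category* C] {X : C}
    {S T : Subobject X} (h : S ≤ T) (h' : T ≤ S) : IsIso (Subobject.ofLE S T h) :=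
  ⟨Subobject.ofLE T S h', by simp, by simp⟩

theorem CategoryTheory.Limits.isIso_cokernel_π_of_isZero {C : Type*} [Category* C]
    [Limits.HasZeroMorphisms C] {X Y : C} (hX : Limits.IsZero X) (f : X ⟶ Y)
    [Limits.HasCokernel f] : IsIso (Limits.cokernel.π f) := by
  obtain rfl : f = 0 := hX.eq_of_src f 0
  infer_instance

namespace GradedSheaf

theorem stalkMap_mk {A : Type u} [CommRing A] {σ : Type*} [SetLike σ A] [AddSubgroupClass σ A]
    {𝒜 : ℕ → σ} [GradedRing 𝒜] {N N' : Type u} [AddCommGroup N] [Module A N] [AddCommGroup N']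
    [Module A N'] (φ : N →ₗ[A] N') (x : ProjectiveSpectrum 𝒜) (m : N) (s : primeComplAt x) :
    stalkMap φ x (LocalizedModule.mk m s) = LocalizedModule.mk (φ m) s :=
  LocalizedModule.map_mk ..

end GradedSheaf

/-- If the sections of `B` killed by `g` lift locally along `f`, the kernel of `g` is contained in
the image of `f`: the composite of the inclusion of the kernel with the projection onto the cokernel
of `f` vanishes locally. -/
theorem AlgebraicGeometry.Scheme.Modules.kernelSubobject_le_imageSubobject {X : Scheme.{u}}
    {A B C : X.Modules} (f : A ⟶ B) (g : B ⟶ C)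
    (h : ∀ (U : X.Opens) (s : B.presheaf.obj (.op U)), g.app U s = 0 → ∀ x : U,
      ∃ (V : X.Opens) (_ : x.1 ∈ V) (i : V ⟶ U) (t : A.presheaf.obj (.op V)),
        f.app V t = B.presheaf.map i.op s) :
    Limits.kernelSubobject g ≤ Limits.imageSubobject f := by
  have key : Limits.kernel.ι g ≫ Limits.cokernel.π f = 0 := by
    refine Scheme.Modules.hom_ext _ _ fun U => ?_
    ext r
    have hr : g.app U ((Limits.kernel.ι g).app U r) = 0 := by
      have := congrArg (fun φ => φ.app U) (Limits.kernel.condition g)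
      exact congr($this r)
    choose V hxV i t ht using h U _ hr
    change (Limits.cokernel.π f).app U ((Limits.kernel.ι g).app U r) = 0
    -- The cokernel is a sheaf, so it suffices that its sections vanish on a cover of `U`.
    refine TopCat.Sheaf.eq_of_locally_eq' ⟨_, (Limits.cokernel f).isSheaf⟩ V U i
      (fun x hx => Opens.mem_iSup.mpr ⟨⟨x, hx⟩, hxV _⟩) _ _ fun x => ?_
    have h1 := congrArg (fun φ => φ.app (V x)) (Limits.cokernel.condition f)
    have h2 : (Limits.cokernel.π f).app (V x) (f.app (V x) (t x)) = 0 := congr($h1 (t x))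
    have h3 := congr($((Limits.cokernel.π f).mapPresheaf.naturality (i x).op)
      ((Limits.kernel.ι g).app U r))
    rw [ht] at h2
    exact h3.symm.trans (h2.trans (map_zero _).symm)
  have him := (ShortComplex.exact_iff_image_eq_kernel _).mp (ShortComplex.exact_cokernel f)
  refine le_of_le_of_eq (Limits.le_kernelSubobject _ _ ?_) him.symm
  rw [← Limits.kernelSubobject_arrow, Category.assoc]
  change _ ≫ Limits.kernel.ι g ≫ Limits.cokernel.π f = 0
  rw [key, Limits.comp_zero]

/-- If `φ` kills the fraction `m / f`, an identity up to powers of `g` on the kernel of `φ` becomes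
the equality `ψ m / (g f) = m / f` in the localization. -/
theorem LocalizedModule.mk_apply_eq_of_smul_sub_eq_zero {A N : Type*} [CommRing A]
    [AddCommGroup N] [Module A N] {S : Submonoid A} {φ ψ : N →ₗ[A] N} {g : A} (hg : g ∈ S)
    (h : ∀ w, φ w = 0 → g • (g • w - ψ w) = 0) {m : N} {f : A} (hf : f ∈ S)
    (h0 : LocalizedModule.mk (φ m) (⟨f, hf⟩ : S) = 0) :
    LocalizedModule.mk (ψ m) (⟨g * f, mul_mem hg hf⟩ : S) = LocalizedModule.mk m ⟨f, hf⟩ := by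
  rw [← LocalizedModule.zero_mk ⟨f, hf⟩, LocalizedModule.mk_eq] at h0
  obtain ⟨u, hu⟩ := h0
  simp only [Submonoid.smul_def, smul_zero] at hu
  -- `u f m` lies in the kernel of `φ` itself, not only in that of its localization.
  have h1 := h ((u.1 * f) • m) (by rw [map_smul, mul_smul, hu])
  rw [LocalizedModule.mk_eq]
  refine ⟨u * ⟨g, hg⟩, ?_⟩
  simp only [Submonoid.smul_def, Submonoid.coe_mul]
  rw [map_smul] at h1
  rw [← sub_eq_zero, ← neg_eq_zero, ← h1]
  module

namespace SlTwo

/-! ### Nilpotency of the action of a nilpotent matrix -/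

section Derivation

variable {R S : Type*} [CommRing R] [CommRing S] [Algebra R S]

/-- The Leibniz rule for powers of `D`; only two terms survive because `D (D u) = 0`. -/
theorem iterate_succ_mul_of_apply_apply_eq_zero (D : Derivation R S S) {u : S} (hu : D (D u) = 0)
    (P : S) (n : ℕ) : D^[n + 1] (u * P) = u * D^[n + 1] P + (n + 1 : ℕ) * (D u * D^[n] P) := by
  induction n with
  | zero => simp [mul_comm]
  | succ n ih =>
    rw [Function.iterate_succ_apply', ih]
    simp only [map_add, Derivation.leibniz, smul_eq_mul, hu, Derivation.map_natCast,
      ← Function.iterate_succ_apply' (f := D)]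
    push_cast
    ring

theorem iterate_mul_eq_zero (D : Derivation R S S) {u : S} (hu : D (D u) = 0) {P : S} {n : ℕ}
    (hP : D^[n] P = 0) : D^[n + 1] (u * P) = 0 := by
  rw [iterate_succ_mul_of_apply_apply_eq_zero D hu, Function.iterate_succ_apply', hP]
  simp

/-- A derivation that squares to zero on `u` and `v` kills a monomial of degree `d` in `u` and
`v` after `d + 1` steps. -/
theorem iterate_pow_mul_pow_eq_zero (D : Derivation R S S) {u v : S} (hu : D (D u) = 0)
    (hv : D (D v) = 0) (m n : ℕ) : D^[m + n + 1] (u ^ m * v ^ n) = 0 := by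
  induction m with
  | zero =>
    induction n with
    | zero => simp
    | succ n ih =>
      rw [pow_succ', mul_left_comm]
      exact iterate_mul_eq_zero D hv ih
  | succ m ih =>
    rw [pow_succ', mul_assoc, show m + 1 + n + 1 = (m + n + 1) + 1 by ring]
    exact iterate_mul_eq_zero D hu ih

end Derivation

section ThetaMatrix

variable {R : Type*} [CommRing R]

/-- The matrix by which `x e + y f + z h` acts on the Weyl module of highest weight `l`, over a
commutative ring. -/
def thetaMatrix (l : ℕ) (x y z : R) : Matrix (Fin (l + 1)) (Fin (l + 1)) R :=
  Matrix.of fun i j =>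
    if (i : ℕ) = j + 1 then (i : ℕ) * y
    else if i = j then ((l : R) - 2 * (i : ℕ)) * z
    else if (j : ℕ) = i + 1 then ((l : R) - (i : ℕ)) * x
    else 0

/-- Reversing the order of the basis exchanges `e` with `f` and changes the sign of `h`. -/
theorem thetaMatrix_rev (l : ℕ) (x y z : R) :
    (thetaMatrix l x y z).submatrix Fin.rev Fin.rev = thetaMatrix l y x (-z) := by
  ext ⟨i, hi⟩ ⟨j, hj⟩
  simp only [thetaMatrix, Matrix.submatrix_apply, Matrix.of_apply, Fin.val_rev, Fin.mk.injEq,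
    Fin.rev_inj]
  have h : ((l + 1 - (i + 1) : ℕ) : R) = l - i := by
    rw [Nat.add_sub_add_right, Nat.cast_sub (by omega)]
  rw [h]
  split_ifs <;> first | omega | skip
  · rfl
  · ring
  · ring
  · rfl

/-- The monomials `a ^ (l - i) * b ^ i`, where `a = X 0` and `b = X 1`. -/
def monomialVec (R : Type*) [CommRing R] (l : ℕ) (i : Fin (l + 1)) : MvPolynomial (Fin 2) R :=
  MvPolynomial.X 0 ^ (l - i : ℕ) * MvPolynomial.X 1 ^ (i : ℕ)

/-- The vector field `x b ∂/∂a + y a ∂/∂b + z (a ∂/∂a - b ∂/∂b)` on the plane. -/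
def planeDerivation (x y z : R) :
    Derivation R (MvPolynomial (Fin 2) R) (MvPolynomial (Fin 2) R) :=
  MvPolynomial.mkDerivation R
    ![x • MvPolynomial.X 1 + z • MvPolynomial.X 0, y • MvPolynomial.X 0 - z • MvPolynomial.X 1]

/-- The vector field acts on the monomials of degree `l` by the transpose of the matrix. -/
theorem planeDerivation_monomialVec (l : ℕ) (x y z : R) (i : Fin (l + 1)) :
    planeDerivation x y z (monomialVec R l i) =
      ∑ j, thetaMatrix l x y z i j • monomialVec R l j := by
  have h0 : planeDerivation x y z (MvPolynomial.X 0) =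
    x • MvPolynomial.X 1 + z • MvPolynomial.X 0 := MvPolynomial.mkDerivation_X _ _ _
  have h1 : planeDerivation x y z (MvPolynomial.X 1) =
    y • MvPolynomial.X 0 - z • MvPolynomial.X 1 := MvPolynomial.mkDerivation_X _ _ _
  have hsplit : ∀ j, thetaMatrix l x y z i j = (if (i : ℕ) = j + 1 then (i : ℕ) * y else 0) +
      (if i = j then ((l : R) - 2 * (i : ℕ)) * z else 0) +
      (if (j : ℕ) = i + 1 then ((l : R) - (i : ℕ)) * x else 0) := by
    intro j
    simp only [thetaMatrix, Matrix.of_apply, Fin.ext_iff]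
    split_ifs <;> first | omega | simp
  have hF : ∑ j : Fin (l + 1), (if (i : ℕ) = j + 1 then (i : ℕ) * y else 0) • monomialVec R l j =
      ((i : ℕ) * y) • (MvPolynomial.X 0 ^ (l - i + 1 : ℕ) * MvPolynomial.X 1 ^ (i - 1 : ℕ)) := by
    obtain ⟨_ | i, hi⟩ := i
    · simp
    · rw [Finset.sum_eq_single ⟨i, by omega⟩]
      · simp [monomialVec, show l - (i + 1) + 1 = l - i by omega]
      · intro j _ hj
        rw [if_neg fun h => hj (Fin.ext (Nat.succ_injective h.symm)), zero_smul]
      · simp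
  have hE : ∑ j : Fin (l + 1),
      (if (j : ℕ) = i + 1 then ((l : R) - (i : ℕ)) * x else 0) • monomialVec R l j =
      (((l : R) - (i : ℕ)) * x) •
        (MvPolynomial.X 0 ^ (l - i - 1 : ℕ) * MvPolynomial.X 1 ^ (i + 1 : ℕ)) := by
    obtain ⟨i, hi⟩ := i
    obtain rfl | hil := eq_or_ne i l
    · simp
    · rw [Finset.sum_eq_single ⟨i + 1, by omega⟩]
      · simp [monomialVec, Nat.sub_sub]
      · intro j _ hj
        rw [if_neg fun h => hj (Fin.ext h), zero_smul]
      · simp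
  simp only [hsplit, add_smul, Finset.sum_add_distrib]
  rw [hF, hE]
  simp only [ite_smul, zero_smul, Finset.sum_ite_eq, Finset.mem_univ, if_true]
  clear hsplit hF hE
  obtain ⟨i, hi⟩ := i
  obtain ⟨m, rfl⟩ := Nat.exists_eq_add_of_le (Nat.le_of_lt_succ hi)
  simp only [monomialVec, Nat.add_sub_cancel_left, Derivation.leibniz, Derivation.leibniz_pow, h0,
    h1, MvPolynomial.smul_eq_C_mul, smul_eq_mul, nsmul_eq_mul, map_mul, map_sub, map_add,
    map_natCast, Nat.cast_add, map_ofNat]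
  cases i <;> cases m <;> simp [pow_succ] <;> ring

theorem planeDerivation_apply_apply {x y z : R} (h : x * y + z ^ 2 = 0) (i : Fin 2) :
    planeDerivation x y z (planeDerivation x y z (MvPolynomial.X i)) = 0 := by
  have h0 : planeDerivation x y z (MvPolynomial.X 0) =
    x • MvPolynomial.X 1 + z • MvPolynomial.X 0 := MvPolynomial.mkDerivation_X _ _ _
  have h1 : planeDerivation x y z (MvPolynomial.X 1) =
    y • MvPolynomial.X 0 - z • MvPolynomial.X 1 := MvPolynomial.mkDerivation_X _ _ _
  fin_cases i
  · simp only [Fin.zero_eta, h0, h1, map_add, Derivation.map_smul, smul_add, smul_sub, smul_smul]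
    match_scalars <;> first | ring1 | linear_combination h
  · simp only [Fin.mk_one, h0, h1, map_sub, Derivation.map_smul, smul_add, smul_sub, smul_smul]
    match_scalars <;> first | ring1 | linear_combination h

theorem linearIndependent_monomialVec (l : ℕ) : LinearIndependent R (monomialVec R l) := by
  have h : monomialVec R l = (MvPolynomial.basisMonomials (Fin 2) R) ∘
      fun i : Fin (l + 1) => Finsupp.single 0 (l - i : ℕ) + Finsupp.single 1 (i : ℕ) := by
    funext i
    simp [monomialVec, MvPolynomial.X_pow_eq_monomial, MvPolynomial.monomial_mul]
  rw [h]
  refine (MvPolynomial.basisMonomials (Fin 2) R).linearIndependent.comp _ fun i j hij => ?_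
  have := DFunLike.congr_fun hij 1
  exact Fin.ext (by simpa using this)

/-- The matrix is nilpotent because its transpose acts on binary forms of degree `l` as a derivation
whose square vanishes on linear forms. -/
theorem thetaMatrix_pow_eq_zero (l : ℕ) {x y z : R} (h : x * y + z ^ 2 = 0) :
    thetaMatrix l x y z ^ (l + 1) = 0 := by
  have key : ∀ (n : ℕ) (i : Fin (l + 1)), (planeDerivation x y z)^[n] (monomialVec R l i) =
      ∑ j, (thetaMatrix l x y z ^ n) i j • monomialVec R l j := by
    intro n
    induction n with
    | zero => intro i; simp [Matrix.one_apply]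
    | succ n ih =>
      intro i
      rw [Function.iterate_succ_apply', ih, map_sum]
      simp only [Derivation.map_smul, planeDerivation_monomialVec, Finset.smul_sum, smul_smul, pow_succ,
        Matrix.mul_apply, Finset.sum_smul]
      exact Finset.sum_comm
  ext i j
  have h0 : (planeDerivation x y z)^[l + 1] (monomialVec R l i) = 0 := by
    have := iterate_pow_mul_pow_eq_zero _ (planeDerivation_apply_apply h 0)
      (planeDerivation_apply_apply h 1) (l - i) i
    rwa [Nat.sub_add_cancel (Nat.le_of_lt_succ i.2)] at this
  rw [key] at h0
  exact Fintype.linearIndependent_iff.mp (linearIndependent_monomialVec l) _ h0 j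

end ThetaMatrix

/-! ### Kernels of Hessenberg matrices -/

/-! A Hessenberg matrix is one whose entries above the superdiagonal vanish. In what follows its
superdiagonal consists of the products `c i * x`. -/

section Hessenberg

variable {R : Type*} [CommRing R] {l : ℕ} {M : Matrix (Fin (l + 1)) (Fin (l + 1)) R}

theorem pow_zero_apply_of_hessenberg (hM : ∀ i j : Fin (l + 1), (i : ℕ) + 1 < j → M i j = 0)
    {n : ℕ} : ∀ j : Fin (l + 1), n < (j : ℕ) → (M ^ n) 0 j = 0 := by
  induction n with
  | zero => intro j hj; exact Matrix.one_apply_ne fun h => by simp [← h] at hj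
  | succ n ih =>
    intro j hj
    rw [pow_succ, Matrix.mul_apply]
    refine Finset.sum_eq_zero fun i _ => ?_
    by_cases hi : n < (i : ℕ)
    · rw [ih i hi, zero_mul]
    · rw [hM i j (by omega), mul_zero]

/-- In row `0` and column `n`, the `n`-th power of a Hessenberg matrix is the product of the first
`n` entries of the superdiagonal: each factor must move one step up in the index. -/
theorem pow_zero_apply_self_of_hessenberg
    (hM : ∀ i j : Fin (l + 1), (i : ℕ) + 1 < j → M i j = 0) {x : R} {c : ℕ → R}
    (hx : ∀ i j : Fin (l + 1), (j : ℕ) = i + 1 → M i j = c i * x) {n : ℕ} :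
    ∀ j : Fin (l + 1), (j : ℕ) = n → (M ^ n) 0 j = (∏ i ∈ Finset.range n, c i) * x ^ n := by
  induction n with
  | zero =>
    intro j hj
    obtain rfl : j = 0 := Fin.ext hj
    simp
  | succ n ih =>
    intro j hj
    have hn : n < l + 1 := by omega
    rw [pow_succ, Matrix.mul_apply, Finset.sum_eq_single ⟨n, hn⟩, ih _ rfl, hx _ _ hj,
      Finset.prod_range_succ]
    · ring
    · intro i _ hi
      have hi' : (i : ℕ) ≠ n := fun h => hi (Fin.ext h)
      rcases lt_or_gt_of_ne hi' with h | h
      · rw [hM i j (by omega), mul_zero]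
      · rw [pow_zero_apply_of_hessenberg hM i h, zero_mul]
    · simp

/-- A vector in the kernel of a Hessenberg matrix is determined by its first coordinate, up to
torsion. -/
theorem pow_mul_eq_zero_of_hessenberg
    (hM : ∀ i j : Fin (l + 1), (i : ℕ) + 1 < j → M i j = 0) {x : R} {c : ℕ → R}
    (hx : ∀ i j : Fin (l + 1), (j : ℕ) = i + 1 → M i j = c i * x)
    (hc : ∀ i < l, IsUnit (c i)) {v : Fin (l + 1) → R} (hv : M.mulVec v = 0) (h0 : v 0 = 0) :
    ∀ (n : ℕ) (i : Fin (l + 1)), (i : ℕ) ≤ n → x ^ n * v i = 0 := by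
  intro n
  induction n with
  | zero =>
    intro i hi
    obtain rfl : i = 0 := Fin.ext (by simpa using hi)
    rw [h0, mul_zero]
  | succ n ih =>
    intro i hi
    rcases Nat.lt_or_ge n i with hni | hni
    · have hi' : (i : ℕ) = n + 1 := by omega
      have hn : n < l + 1 := by omega
      have h := congrFun hv ⟨n, hn⟩
      replace h : x ^ n * ∑ j, M ⟨n, hn⟩ j * v j = 0 := by
        rw [show ∑ j, M ⟨n, hn⟩ j * v j = 0 from h, mul_zero]
      rw [Finset.mul_sum, Finset.sum_eq_single i, hx _ _ hi'] at h
      · rw [← (hc n (by omega)).mul_right_eq_zero, ← h]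
        ring
      · intro j _ hj
        have hj' : (j : ℕ) ≠ n + 1 := fun h => hj (Fin.ext (h.trans hi'.symm))
        rcases lt_or_gt_of_ne hj' with h | h
        · rw [mul_left_comm, ih j (by omega), mul_zero]
        · rw [hM _ j h, zero_mul, mul_zero]
      · simp
    · rw [pow_succ', mul_assoc, ih i hni, mul_zero]

/-- If `M` is a nilpotent Hessenberg matrix, a vector `v` in its kernel is, up to torsion and
powers of `x`, the multiple of the last column of `M ^ l` with the same first coordinate. -/
theorem pow_mul_smul_sub_eq_zero_of_hessenberg
    (hM : ∀ i j : Fin (l + 1), (i : ℕ) + 1 < j → M i j = 0) {x : R} {c : ℕ → R}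
    (hx : ∀ i j : Fin (l + 1), (j : ℕ) = i + 1 → M i j = c i * x)
    (hc : ∀ i < l, IsUnit (c i)) (hnil : M ^ (l + 1) = 0)
    {v : Fin (l + 1) → R} (hv : M.mulVec v = 0) :
    x ^ l • (((∏ i ∈ Finset.range l, c i) * x ^ l) • v -
      (M ^ l).mulVec (Pi.single (Fin.last l) (v 0))) = 0 := by
  funext i
  refine pow_mul_eq_zero_of_hessenberg hM hx hc ?_ ?_ l i (Nat.le_of_lt_succ i.2)
  · rw [Matrix.mulVec_sub, Matrix.mulVec_smul, hv, Matrix.mulVec_mulVec, ← pow_succ', hnil,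
      Matrix.zero_mulVec, smul_zero, sub_zero]
  · rw [Pi.sub_apply, Pi.smul_apply, Matrix.mulVec_single]
    simp [pow_zero_apply_self_of_hessenberg hM hx (n := l) (Fin.last l) rfl]

end Hessenberg

/-! ### The kernel is the image of the highest nonzero power -/

section Exactness

variable {k R : Type*} [Field k] [CommRing R] [Algebra k R] {l : ℕ}

theorem prod_range_sub_natCast_ne_zero (hl : ∀ i : ℕ, i < l → (l : k) - i ≠ 0) :
    ∏ i ∈ Finset.range l, ((l : k) - i) ≠ 0 :=
  Finset.prod_ne_zero_iff.mpr fun i hi => hl i (Finset.mem_range.mp hi)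

/-- Over the locus where `x` is invertible, the kernel of the matrix is the image of its `l`-th
power: it is generated by the last column of that power. -/
theorem pow_smul_sub_thetaMatrix_pow_eq_zero (hl : ∀ i : ℕ, i < l → (l : k) - i ≠ 0) {x y z : R}
    (h : x * y + z ^ 2 = 0) {v : Fin (l + 1) → R} (hv : (thetaMatrix l x y z).mulVec v = 0) :
    x ^ l • (x ^ l • v - (thetaMatrix l x y z ^ l).mulVec
      (Pi.single (Fin.last l) ((∏ i ∈ Finset.range l, ((l : k) - i))⁻¹ • v 0))) = 0 := by
  have hc : ∀ i : ℕ, (l : R) - i = algebraMap k R ((l : k) - i) := by simp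
  have key := pow_mul_smul_sub_eq_zero_of_hessenberg (M := thetaMatrix l x y z) (x := x)
    (c := fun i => (l : R) - i) (fun i j hij => ?_) (fun i j hij => ?_)
    (fun i hi => by rw [hc]; exact (hl i hi).isUnit.map _) (thetaMatrix_pow_eq_zero l h) hv
  · have hprod : ∏ i ∈ Finset.range l, ((l : R) - i) =
        algebraMap k R (∏ i ∈ Finset.range l, ((l : k) - i)) := by
      rw [map_prod]; exact Finset.prod_congr rfl fun i _ => hc i
    have ha := prod_range_sub_natCast_ne_zero hl
    rw [hprod] at key
    set a := ∏ i ∈ Finset.range l, ((l : k) - i)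
    rw [Pi.single_smul, Matrix.mulVec_smul]
    have h2 := congrArg (a⁻¹ • ·) key
    simp only [smul_zero] at h2
    rw [← h2, smul_comm, smul_sub a⁻¹, mul_smul, algebraMap_smul, inv_smul_smul₀ ha]
  · simp only [thetaMatrix, Matrix.of_apply]
    rw [if_neg (by omega), if_neg (fun h => by omega), if_neg (by omega)]
  · simp only [thetaMatrix, Matrix.of_apply]
    rw [if_neg (by omega), if_neg (fun h => by omega), if_pos hij]

/-- Over the locus where `x` or `y` is invertible, the kernel of the matrix is the image of its
`l`-th power. -/
theorem exists_pow_smul_sub_thetaMatrix_pow_eq_zero (hl : ∀ i : ℕ, i < l → (l : k) - i ≠ 0)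
    {x y z : R} (h : x * y + z ^ 2 = 0) {g : R} (hg : g = x ∨ g = y) :
    ∃ (i j : Fin (l + 1)) (a : k), ∀ v : Fin (l + 1) → R, (thetaMatrix l x y z).mulVec v = 0 →
      g ^ l • (g ^ l • v - (thetaMatrix l x y z ^ l).mulVec (Pi.single i (a • v j))) = 0 := by
  obtain rfl | rfl := hg
  · exact ⟨_, _, _, fun v hv => pow_smul_sub_thetaMatrix_pow_eq_zero hl h hv⟩
  · refine ⟨0, Fin.last l, (∏ i ∈ Finset.range l, ((l : k) - i))⁻¹, fun v hv => ?_⟩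
    have hM : ∀ w : Fin (l + 1) → R, (thetaMatrix l g x (-z)).mulVec (w ∘ Fin.rev) =
        (thetaMatrix l x g z).mulVec w ∘ Fin.rev := fun w => by
      rw [← thetaMatrix_rev]
      exact Matrix.submatrix_mulVec_equiv _ _ _ Fin.revPerm |>.trans (by
        congr 2; funext i; simp)
    have hMn : ∀ (n : ℕ) (w : Fin (l + 1) → R), (thetaMatrix l g x (-z) ^ n).mulVec (w ∘ Fin.rev) =
        (thetaMatrix l x g z ^ n).mulVec w ∘ Fin.rev := by
      intro n
      induction n with
      | zero => intro w; simp
      | succ n ih => intro w; rw [pow_succ, ← Matrix.mulVec_mulVec, hM, ih, Matrix.mulVec_mulVec,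
          ← pow_succ]
    have key := pow_smul_sub_thetaMatrix_pow_eq_zero hl (x := g) (y := x) (z := -z)
      (by linear_combination h) (v := v ∘ Fin.rev) (by rw [hM, hv]; rfl)
    have hs : ∀ b : R, (Pi.single (Fin.last l) b : Fin (l + 1) → R) =
        (Pi.single 0 b : Fin (l + 1) → R) ∘ Fin.rev := fun b => by
      funext i
      simp only [Function.comp_apply, Pi.single_apply, ← Fin.rev_last, Fin.rev_inj]
    rw [hs, hMn] at key
    funext i
    have := congrFun key i.rev
    simpa using this

end Exactness

/-! ### The matrix over the polynomial ring -/

section Polynomial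

variable (k : Type u) [Field k] (l : ℕ)

theorem matB_eq_thetaMatrix : matB k l = thetaMatrix l (MvPolynomial.X 0 ^ 2)
    (-(MvPolynomial.X 1 ^ 2)) (MvPolynomial.X 0 * MvPolynomial.X 1) := by
  ext1 i j
  simp only [matB, thetaMatrix, Matrix.of_apply, mul_neg, neg_mul]

theorem matB_pow_eq_zero : matB k l ^ (l + 1) = 0 := by
  rw [matB_eq_thetaMatrix]
  exact thetaMatrix_pow_eq_zero l (by ring)

/-- A finitely generated module over a polynomial ring in finitely many variables that is killed by
a power of each variable is finite dimensional. -/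
theorem finite_of_pow_smul_eq_zero {σ Q : Type*} [Finite σ] [AddCommGroup Q]
    [Module (MvPolynomial σ k) Q] [Module k Q] [IsScalarTower k (MvPolynomial σ k) Q]
    [Module.Finite (MvPolynomial σ k) Q] (N : ℕ)
    (h : ∀ (i : σ) (q : Q), (MvPolynomial.X i ^ N : MvPolynomial σ k) • q = 0) :
    Module.Finite k Q := by
  obtain ⟨G, hG⟩ := (Module.Finite.fg_top : (⊤ : Submodule (MvPolynomial σ k) Q).FG)
  have hfin : {d : σ →₀ ℕ | ∀ i, d i < N}.Finite := by
    exact (Set.Finite.pi' fun _ : σ => Set.finite_Iio N).preimage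
      (DFunLike.coe_injective (F := σ →₀ ℕ)).injOn
  -- `T` consists of the products of a generator with a monomial of exponents less than `N`.
  let T : Set Q := Set.image2 (fun (d : σ →₀ ℕ) q => MvPolynomial.monomial d (1 : k) • q)
    {d | ∀ i, d i < N} (G : Set Q)
  have hT : T.Finite := hfin.image2 _ G.finite_toSet
  have hmon : ∀ q ∈ G, ∀ P : MvPolynomial σ k, P • q ∈ Submodule.span k T := by
    intro q hq P
    induction P using MvPolynomial.induction_on' with
    | add P P' h1 h2 => rw [add_smul]; exact add_mem h1 h2
    | monomial d a =>
      rw [show MvPolynomial.monomial d a = a • MvPolynomial.monomial d (1 : k) by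
        rw [MvPolynomial.smul_monomial, smul_eq_mul, mul_one], smul_assoc]
      refine Submodule.smul_mem _ _ ?_
      by_cases hd : ∀ i, d i < N
      · exact Submodule.subset_span ⟨d, hd, q, hq, rfl⟩
      · push Not at hd
        obtain ⟨i, hi⟩ := hd
        have hdi : d = (d - Finsupp.single i N) + Finsupp.single i N :=
          (tsub_add_cancel_of_le (Finsupp.single_le_iff.mpr hi)).symm
        rw [hdi, ← one_mul (1 : k), ← MvPolynomial.monomial_mul, mul_smul,
          ← MvPolynomial.X_pow_eq_monomial, h, smul_zero]
        exact zero_mem _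
  have hspan : ∀ q ∈ Submodule.span (MvPolynomial σ k) (G : Set Q), ∀ P : MvPolynomial σ k,
      P • q ∈ Submodule.span k T := by
    intro q hq
    induction hq using Submodule.span_induction with
    | mem q hq => exact hmon q hq
    | zero => intro P; rw [smul_zero]; exact zero_mem _
    | add q q' _ _ h1 h2 => intro P; rw [smul_add]; exact add_mem (h1 P) (h2 P)
    | smul P' q _ h1 => intro P; rw [← mul_smul]; exact h1 _
  refine ⟨Submodule.fg_def.mpr ⟨T, hT, eq_top_iff.mpr fun q _ => ?_⟩⟩
  simpa using hspan q (hG ▸ Submodule.mem_top) 1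

theorem finite_ker_matB_quotient (hl : ∀ i : ℕ, i < l → (l : k) - i ≠ 0) :
    Module.Finite k
      (↥(LinearMap.ker (matB k l).mulVecLin) ⧸
        (LinearMap.range (matB k l ^ l).mulVecLin).submoduleOf
          (LinearMap.ker (matB k l).mulVecLin)) := by
  refine finite_of_pow_smul_eq_zero (σ := Fin 2) k (2 * l) fun r q => ?_
  obtain ⟨⟨v, hv⟩, rfl⟩ := Submodule.Quotient.mk_surjective _ q
  rw [← Submodule.Quotient.mk_smul, Submodule.Quotient.mk_eq_zero]
  have key : ∀ g : MvPolynomial (Fin 2) k, g ≠ 0 → g = MvPolynomial.X 0 ^ 2 ∨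
      g = -(MvPolynomial.X 1 ^ 2) → ∃ w, (matB k l ^ l).mulVec w = g ^ l • v := by
    intro g hg0 hg
    obtain ⟨i, j, a, h⟩ := exists_pow_smul_sub_thetaMatrix_pow_eq_zero (l := l) hl
      (x := MvPolynomial.X 0 ^ 2) (y := -(MvPolynomial.X 1 ^ 2))
      (z := MvPolynomial.X 0 * MvPolynomial.X 1) (by ring) hg
    rw [← matB_eq_thetaMatrix] at h
    have h1 := (smul_eq_zero_iff_right (pow_ne_zero l hg0)).mp (h v (by simpa using hv))
    exact ⟨_, (sub_eq_zero.mp h1).symm⟩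
  fin_cases r
  · obtain ⟨w, hw⟩ := key _ (pow_ne_zero 2 (MvPolynomial.X_ne_zero 0)) (Or.inl rfl)
    refine ⟨w, hw.trans ?_⟩
    rw [← pow_mul]
    rfl
  · obtain ⟨w, hw⟩ := key _ (neg_ne_zero.mpr (pow_ne_zero 2 (MvPolynomial.X_ne_zero 1)))
      (Or.inr rfl)
    refine ⟨(-1 : MvPolynomial (Fin 2) k) ^ l • w, ?_⟩
    change (matB k l ^ l).mulVec _ = (MvPolynomial.X 1 ^ (2 * l) : MvPolynomial (Fin 2) k) • v
    rw [Matrix.mulVec_smul, hw, smul_smul, ← mul_pow, neg_one_mul, neg_neg, ← pow_mul]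

end Polynomial

/-! ### The operator on the coordinate ring tensored with the Weyl module -/

section WeylTheta

open TensorProduct

variable (p : ℕ) (k : Type u) [Field k] (l : ℕ)

/-- A nilpotent matrix of trace zero has determinant `-(x y + z²) = 0`. -/
theorem coordFun_mul_add_sq (hp : p ≠ 0) :
    coordFun p k 0 * coordFun p k 1 + coordFun p k 2 ^ 2 = 0 := by
  simp only [coordFun, ← map_mul, ← map_pow, ← map_add]
  rw [Ideal.Quotient.eq_zero_iff_mem]
  rintro _ ⟨X, hX, rfl⟩
  have hdet : X.1.det = 0 := by
    have h : X.1 ^ p = 0 := hX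
    have h' := congrArg Matrix.det h
    rw [Matrix.det_pow, Matrix.det_zero] at h'
    exact (pow_eq_zero_iff hp).mp h'
  have htr : Matrix.trace X.1 = 0 := X.2
  rw [Matrix.det_fin_two] at hdet
  rw [Matrix.trace_fin_two] at htr
  simp only [map_add, map_mul, map_pow, MvPolynomial.aeval_X, coords, Matrix.cons_val]
  linear_combination X.1 0 0 * htr - hdet

/-- Coordinates with respect to the standard basis of the Weyl module. -/
def weylCoord : CoordRing p k ⊗[k] WeylModule k l ≃ₗ[CoordRing p k] (Fin (l + 1) → CoordRing p k) :=
  TensorProduct.piScalarRight k (CoordRing p k) (CoordRing p k) (Fin (l + 1))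

theorem weylCoord_tmul (a : CoordRing p k) (v : WeylModule k l) (i : Fin (l + 1)) :
    weylCoord p k l (a ⊗ₜ v) i = (v i : k) • a :=
  congrFun (TensorProduct.piScalarRight_apply k (CoordRing p k) (CoordRing p k) (Fin (l + 1))
    (a ⊗ₜ v)) i

theorem weylCoord_theta (w : CoordRing p k ⊗[k] WeylModule k l) :
    weylCoord p k l (theta p k (WeylModule k l) w) =
      (thetaMatrix l (coordFun p k 0) (coordFun p k 1) (coordFun p k 2)).mulVec
        (weylCoord p k l w) := by
  induction w with
  | zero => simp
  | add w w' h h' => rw [map_add, map_add, h, h', map_add, Matrix.mulVec_add]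
  | tmul a v =>
    have hE : weylMatrix l (slE k) = weylE k l := by
      simp [weylMatrix, slE, LieAlgebra.SpecialLinear.val_single]
    have hF : weylMatrix l (slF k) = weylF k l := by
      simp [weylMatrix, slF, LieAlgebra.SpecialLinear.val_single]
    have hH : weylMatrix l (slH k) = weylH k l := by
      simp [weylMatrix, slH, LieAlgebra.SpecialLinear.val_singleSubSingle]
    have hs : ∀ (c : k) (b : CoordRing p k), c • b = algebraMap k (CoordRing p k) c * b :=
      fun c b => Algebra.smul_def c b
    have hlie : ∀ (X : Sl k) (b : CoordRing p k) (i : Fin (l + 1)),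
        weylCoord p k l (b ⊗ₜ ⁅X, v⁆) i = ∑ j, (weylMatrix l X i j * v j : k) • b := by
      intro X b i
      rw [weylCoord_tmul, ← Finset.sum_smul]
      rfl
    rw [theta_tmul]
    funext i
    rw [map_add, map_add, Pi.add_apply, Pi.add_apply, hlie, hlie, hlie, hE, hF, hH,
      ← Finset.sum_add_distrib, ← Finset.sum_add_distrib]
    refine Finset.sum_congr rfl fun j _ => ?_
    rw [weylCoord_tmul]
    simp only [thetaMatrix, weylE, weylF, weylH, Matrix.of_apply, Matrix.diagonal_apply,
      hs]
    obtain ⟨i, hi⟩ := i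
    obtain ⟨j, hj⟩ := j
    simp only [Fin.mk.injEq]
    split_ifs with h1 h2 h3 h4 h5 h6 <;> first | omega | skip
    all_goals subst_vars
    all_goals simp [map_ofNat (algebraMap k (CoordRing p k)) 2]
    all_goals ring

theorem weylCoord_theta_pow (n : ℕ) (w : CoordRing p k ⊗[k] WeylModule k l) :
    weylCoord p k l ((theta p k (WeylModule k l) ^ n) w) =
      (thetaMatrix l (coordFun p k 0) (coordFun p k 1) (coordFun p k 2) ^ n).mulVec
        (weylCoord p k l w) := by
  induction n with
  | zero => simp
  | succ n ih =>
    rw [pow_succ', Module.End.mul_apply, weylCoord_theta, ih, Matrix.mulVec_mulVec, ← pow_succ']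

theorem theta_pow_eq_zero (hp : p ≠ 0) : theta p k (WeylModule k l) ^ (l + 1) = 0 := by
  refine LinearMap.ext fun w => (weylCoord p k l).injective ?_
  rw [weylCoord_theta_pow, thetaMatrix_pow_eq_zero l (coordFun_mul_add_sq p k hp)]
  simp

/-- Where the coordinate function `x` or `y` is invertible, the kernel of `Θ` is contained in the
image of `Θ ^ l`, and a preimage can be chosen by a map `L` of degree zero. -/
theorem exists_theta_pow_lift [Infinite k] (hp : p ≠ 0) (hl : ∀ i : ℕ, i < l → (l : k) - i ≠ 0)
    {g : CoordRing p k} (hg : g = coordFun p k 0 ∨ g = coordFun p k 1) :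
    ∃ L : CoordRing p k ⊗[k] WeylModule k l →ₗ[CoordRing p k] CoordRing p k ⊗[k] WeylModule k l,
      GradedSheaf.IsHomogeneousOfDegree (freePieces p k (WeylModule k l))
        (freePieces p k (WeylModule k l)) L 0 ∧
      ∀ w, theta p k (WeylModule k l) w = 0 →
        g ^ l • (g ^ l • w - (theta p k (WeylModule k l) ^ l) (L w)) = 0 := by
  obtain ⟨i, j, a, h⟩ := exists_pow_smul_sub_thetaMatrix_pow_eq_zero (l := l) hl
    (coordFun_mul_add_sq p k hp) hg
  -- The lift is defined over `k`, so its base change preserves degrees.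
  let φ : WeylModule k l →ₗ[k] WeylModule k l :=
    LinearMap.single k (fun _ : Fin (l + 1) => k) i ∘ₗ (a • LinearMap.proj j)
  have hφ : ∀ w, weylCoord p k l (φ.baseChange (CoordRing p k) w) =
      Pi.single i (a • weylCoord p k l w j) := by
    intro w
    induction w with
    | zero => simp
    | add w w' h h' => rw [map_add, map_add, h, h', map_add, Pi.add_apply, smul_add, Pi.single_add]
    | tmul b v =>
      rw [LinearMap.baseChange_tmul]
      funext m
      rw [weylCoord_tmul, weylCoord_tmul]
      change (Pi.single i (a * v j) : Fin (l + 1) → k) m • b = _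
      rcases eq_or_ne m i with rfl | hm
      · simp [mul_smul]
      · simp [hm]
  refine ⟨φ.baseChange (CoordRing p k), fun n w hw => ?_, fun w hw => ?_⟩
  · rw [add_zero]
    induction hw using AddSubgroup.closure_induction with
    | mem w hw =>
      obtain ⟨d, b, v, hd, hb, rfl⟩ := hw
      exact AddSubgroup.subset_closure ⟨d, b, φ v, hd, hb, LinearMap.baseChange_tmul _ _ _⟩
    | zero => rw [map_zero]; exact zero_mem _
    | add x y _ _ hx hy => rw [map_add]; exact add_mem hx hy
    | neg x _ hx => rw [map_neg]; exact neg_mem hx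
  · refine (weylCoord p k l).injective ?_
    rw [map_smul, map_sub, map_smul, weylCoord_theta_pow, hφ, map_zero]
    exact h _ (by rw [← weylCoord_theta, hw, map_zero])

end WeylTheta

/-! ### Exactness on the projectivized nullcone -/

section Sheaf

open TensorProduct

variable (p : ℕ) (k : Type u) [Field k] [Infinite k]

/-- The open sets `x ≠ 0` and `y ≠ 0` cover the projectivized nullcone, since `z² = -x y`. -/
theorem coordFun_notMem_or (hp : p ≠ 0) (P : ProjectiveSpectrum (coordGrading p k)) :
    coordFun p k 0 ∉ P.asHomogeneousIdeal ∨ coordFun p k 1 ∉ P.asHomogeneousIdeal := by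
  by_contra! h
  have hprime := P.isPrime
  have h2 : coordFun p k 2 ∈ P.asHomogeneousIdeal := by
    refine hprime.mem_of_pow_mem 2 ?_
    rw [eq_neg_of_add_eq_zero_right (coordFun_mul_add_sq p k hp)]
    exact neg_mem (Ideal.mul_mem_left _ _ h.2)
  refine P.not_irrelevant_le ((HomogeneousIdeal.irrelevant_le _).mpr ?_)
  rintro n hn _ ⟨F, hF, rfl⟩
  have hF' : F ∈ Ideal.span (MvPolynomial.X '' (Set.univ : Set (Fin 3))) := by
    rw [MvPolynomial.mem_ideal_span_X_image]
    intro m hm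
    by_contra! h0
    have hm0 : m = 0 := Finsupp.ext fun i => h0 i trivial
    have hdeg := hF (MvPolynomial.mem_support_iff.mp hm)
    rw [hm0, map_zero] at hdeg
    omega
  have hle : Ideal.span (MvPolynomial.X '' (Set.univ : Set (Fin 3))) ≤
      P.asHomogeneousIdeal.toIdeal.comap (Ideal.Quotient.mk (nullconeIdeal p k)) := by
    rw [Ideal.span_le]
    rintro _ ⟨i, -, rfl⟩
    fin_cases i
    exacts [h.1, h.2, h2]
  exact hle hF'

variable (M : Type u) [AddCommGroup M] [Module k M]

variable {p k} in
/-- A point of the projectivized nullcone as a homogeneous prime ideal; this is the identity, but it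
fixes the type over which localizations are indexed. -/
def homogeneousPrime (x : ProjNullcone p k) : ProjectiveSpectrum (coordGrading p k) := x

variable {p k M} in
/-- The value at a point of a section of `M̃(n)`, in the localization of `k[𝒩] ⊗ M`. -/
def sectionVal {n : ℤ} {U : (ProjNullcone p k).Opens}
    (s : (tildeTwist p k M n).presheaf.obj (.op U)) (x : U) :
    GradedSheaf.StalkAt (CoordRing p k ⊗[k] M) (homogeneousPrime x.1) :=
  Subtype.val (p := (· ∈ GradedSheaf.sections (freePieces p k M) n U)) s x

variable {p k M} in
theorem sectionVal_injective {n : ℤ} {U : (ProjNullcone p k).Opens}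
    {s t : (tildeTwist p k M n).presheaf.obj (.op U)} (h : ∀ x, sectionVal s x = sectionVal t x) :
    s = t :=
  Subtype.ext (p := (· ∈ GradedSheaf.sections (freePieces p k M) n U)) (funext h)

variable {p k M} in
theorem exists_sectionVal_eq_mk {n : ℤ} {U : (ProjNullcone p k).Opens}
    (s : (tildeTwist p k M n).presheaf.obj (.op U)) (x : U) :
    ∃ (V : (ProjNullcone p k).Opens) (_ : x.1 ∈ V) (i : V ⟶ U) (d : ℕ)
      (m : CoordRing p k ⊗[k] M) (f : CoordRing p k), f ∈ coordGrading p k d ∧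
      m ∈ (freePieces p k M).piece (d + n) ∧
      ∀ y : V, ∃ hf : f ∈ GradedSheaf.primeComplAt (homogeneousPrime y.1),
        sectionVal s ⟨y.1, i.le y.2⟩ = LocalizedModule.mk m ⟨f, hf⟩ :=
  have ⟨V, hx, i, d, m, f, hf, hm, w⟩ :=
    Subtype.property (p := (· ∈ GradedSheaf.sections (freePieces p k M) n U)) s x
  ⟨V, hx, i, d, m, f, hf, hm, w⟩

variable {p k M} in
/-- The section `m / f` of `M̃(n)`, for `m` of degree `d + n` and `f` of degree `d` without zeros on
`U`. -/
def fractionSection {n : ℤ} (U : (ProjNullcone p k).Opens) (d : ℕ) (m : CoordRing p k ⊗[k] M)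
    (f : CoordRing p k) (hf : f ∈ coordGrading p k d) (hm : m ∈ (freePieces p k M).piece (d + n))
    (hU : ∀ y : U, f ∈ GradedSheaf.primeComplAt (homogeneousPrime y.1)) :
    (tildeTwist p k M n).presheaf.obj (.op U) :=
  Subtype.mk (p := (· ∈ GradedSheaf.sections (freePieces p k M) n U))
    (fun y => LocalizedModule.mk m ⟨f, hU y⟩)
    fun y => ⟨U, y.2, 𝟙 _, d, m, f, hf, hm, fun z => ⟨hU z, rfl⟩⟩

variable [LieRingModule (Sl k) M] [LieModule k (Sl k) M]

theorem sectionVal_globalOp_app {m n : ℤ} (h : m + 1 = n) {U : (ProjNullcone p k).Opens}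
    (s : (tildeTwist p k M m).presheaf.obj (.op U)) (x : U) :
    sectionVal ((globalOp p k M m n h).app U s) x =
      GradedSheaf.stalkMap (theta p k M) (homogeneousPrime x.1) (sectionVal s x) := rfl

theorem sectionVal_globalOpPow_app (j : ℕ) : ∀ {m n : ℤ} (h : m + j = n)
    {U : (ProjNullcone p k).Opens} (s : (tildeTwist p k M m).presheaf.obj (.op U)) (x : U),
    sectionVal ((globalOpPow p k M j m n h).app U s) x =
      GradedSheaf.stalkMap (theta p k M ^ j) (homogeneousPrime x.1) (sectionVal s x) := by
  induction j with
  | zero =>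
    intro m n h U s x
    obtain rfl : m = n := by simpa using h
    have h1 : (globalOpPow p k M 0 m m h).app U s = s := rfl
    rw [h1, pow_zero]
    generalize sectionVal s x = w
    induction w using LocalizedModule.induction_on with
    | h m s => rw [GradedSheaf.stalkMap_mk, Module.End.one_apply]
  | succ j ih =>
    intro m n h U s x
    have h1 : (globalOpPow p k M (j + 1) m n h).app U s =
      (globalOpPow p k M j (m + 1) n (by rw [← h]; push_cast; ring)).app U
        ((globalOp p k M m (m + 1) rfl).app U s) := rfl
    rw [h1, ih, sectionVal_globalOp_app, pow_succ]
    generalize sectionVal s x = w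
    induction w using LocalizedModule.induction_on with
    | h m s => simp only [GradedSheaf.stalkMap_mk, Module.End.mul_apply]

variable (l : ℕ)

theorem globalOpPow_succ_eq_zero (hp : p ≠ 0) {m n : ℤ} (h : m + (l + 1 : ℕ) = n) :
    globalOpPow p k (WeylModule k l) (l + 1) m n h = 0 := by
  refine Scheme.Modules.hom_ext _ _ fun U => ?_
  ext s
  refine sectionVal_injective fun x => ?_
  rw [sectionVal_globalOpPow_app, theta_pow_eq_zero p k l hp]
  generalize sectionVal s x = w
  induction w using LocalizedModule.induction_on with
  | h m s =>
    rw [GradedSheaf.stalkMap_mk, LinearMap.zero_apply]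
    exact LocalizedModule.zero_mk _

/-- A section of the kernel of `Θ` lifts locally along `Θ ^ l`. -/
theorem exists_local_lift (hp : p ≠ 0) (hl : ∀ i : ℕ, i < l → (l : k) - i ≠ 0)
    {U : (ProjNullcone p k).Opens}
    (s : (tildeTwist p k (WeylModule k l) 0).presheaf.obj (.op U))
    (hs : ∀ x : U, GradedSheaf.stalkMap (theta p k (WeylModule k l)) (homogeneousPrime x.1)
      (sectionVal s x) = 0) (x : U) :
    ∃ (V : (ProjNullcone p k).Opens) (_ : x.1 ∈ V) (i : V ⟶ U)
      (t : (tildeTwist p k (WeylModule k l) (-l)).presheaf.obj (.op V)),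
      (globalOpPow p k (WeylModule k l) l (-l) 0 (neg_add_cancel _)).app V t =
        (tildeTwist p k (WeylModule k l) 0).presheaf.map i.op s := by
  obtain ⟨V, hxV, i, d, m, f, hf, hm, w⟩ := exists_sectionVal_eq_mk s x
  obtain ⟨g, hg, hg1, hgx⟩ : ∃ g, (g = coordFun p k 0 ∨ g = coordFun p k 1) ∧
      g ∈ coordGrading p k 1 ∧ g ∉ (homogeneousPrime x.1).asHomogeneousIdeal := by
    rcases coordFun_notMem_or p k hp (homogeneousPrime x.1) with h | h
    · exact ⟨_, Or.inl rfl, coordFun_mem p k 0, h⟩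
    · exact ⟨_, Or.inr rfl, coordFun_mem p k 1, h⟩
  obtain ⟨L, hL, hLθ⟩ := exists_theta_pow_lift p k l hp hl hg
  let W : (ProjNullcone p k).Opens := V ⊓ Proj.basicOpen (coordGrading p k) g
  have hgW : ∀ y : W, g ^ l ∈ GradedSheaf.primeComplAt (homogeneousPrime y.1) := fun y =>
    (GradedSheaf.primeComplAt _).pow_mem
      (show g ∉ (homogeneousPrime y.1).asHomogeneousIdeal from y.2.2) l
  have hfW : ∀ y : W, f ∈ GradedSheaf.primeComplAt (homogeneousPrime y.1) := fun y =>
    (w ⟨y.1, y.2.1⟩).1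
  refine ⟨W, ⟨hxV, hgx⟩, homOfLE inf_le_left ≫ i,
    fractionSection W (l + d) (L m) (g ^ l * f) (SetLike.mul_mem_graded
      (by simpa using SetLike.pow_mem_graded l hg1) hf) ?_ fun y => mul_mem (hgW y) (hfW y),
    sectionVal_injective fun y => ?_⟩
  · have := hL _ _ hm
    rwa [show ((l + d : ℕ) : ℤ) + -l = d + 0 + 0 by push_cast; ring]
  rw [sectionVal_globalOpPow_app]
  have hy : sectionVal s ⟨y.1, i.le y.2.1⟩ = LocalizedModule.mk m ⟨f, hfW y⟩ :=
    (w ⟨y.1, y.2.1⟩).2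
  have h0 := hs ⟨y.1, i.le y.2.1⟩
  rw [hy, GradedSheaf.stalkMap_mk] at h0
  change GradedSheaf.stalkMap (theta p k (WeylModule k l) ^ l) (homogeneousPrime y.1)
    (LocalizedModule.mk (L m) ⟨g ^ l * f, mul_mem (hgW y) (hfW y)⟩) =
    sectionVal s ⟨y.1, i.le y.2.1⟩
  rw [hy, GradedSheaf.stalkMap_mk]
  exact LocalizedModule.mk_apply_eq_of_smul_sub_eq_zero
    (ψ := (theta p k (WeylModule k l) ^ l) ∘ₗ L) (hgW y) hLθ (hfW y) h0

theorem kerSub_one_le_imSub (hp : p ≠ 0) (hl : ∀ i : ℕ, i < l → (l : k) - i ≠ 0) :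
    kerSub p k (WeylModule k l) 1 ≤ imSub p k (WeylModule k l) l := by
  refine Scheme.Modules.kernelSubobject_le_imageSubobject _ _ fun U s hs x => ?_
  refine exists_local_lift p k l hp hl s (fun x => ?_) x
  have := sectionVal_globalOpPow_app p k (WeylModule k l) 1 (zero_add _) s x
  rw [hs, pow_one] at this
  exact this.symm

/-! ### The filtration of the kernel -/

variable (M : Type u) [AddCommGroup M] [Module k M] [LieRingModule (Sl k) M] [LieModule k (Sl k) M]

theorem imSub_antitone : Antitone (imSub p k M) :=
  antitone_nat_of_succ_le (imSub_succ_le p k M)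

/-- In this case `ker Θ ∩ im Θ ^ i` and `ker Θ ∩ im Θ ^ (i - 1)` both equal `ker Θ`. -/
theorem isZero_sheafF_of_le {i : ℕ} (h : kerSub p k M 1 ≤ imSub p k M i) :
    Limits.IsZero (sheafF p k M i) := by
  have := Subobject.isIso_ofLE_of_ge (inf_le_inf_left (kerSub p k M 1) (imSub_le_pred p k M i))
    (le_inf inf_le_left (inf_le_left.trans h))
  exact Limits.isZero_cokernel_of_epi _

theorem isZero_sheafF_of_eq_bot {i : ℕ} (h : imSub p k M (i - 1) = ⊥) :
    Limits.IsZero (sheafF p k M i) :=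
  have : Epi (sheafFπ p k M i) := inferInstanceAs (Epi (Limits.cokernel.π _))
  Limits.IsZero.of_epi (sheafFπ p k M i) (Subobject.isZero_of_le_bot (inf_le_right.trans h.le))

/-- If the kernel of `Θ` lies in the image of `Θ ^ l` and `Θ ^ (l + 1)` vanishes, the filtration
jumps only at `l + 1`, where the quotient is the whole kernel. -/
theorem exists_iso_kerSub {l : ℕ} (h : kerSub p k M 1 ≤ imSub p k M l)
    (h' : imSub p k M (l + 1) = ⊥) :
    ∃ φ : sheafF p k M (l + 1) ≅ (kerSub p k M 1 : (ProjNullcone p k).Modules),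
      sheafFπ p k M (l + 1) ≫ φ.hom = Subobject.ofLE _ _ inf_le_left := by
  have hz : Limits.IsZero
      ((kerSub p k M 1 ⊓ imSub p k M (l + 1) : Subobject _) : (ProjNullcone p k).Modules) :=
    Subobject.isZero_of_le_bot (inf_le_right.trans h'.le)
  have h1 : IsIso (sheafFπ p k M (l + 1)) := Limits.isIso_cokernel_π_of_isZero hz _
  have h2 := Subobject.isIso_ofLE_of_ge (S := kerSub p k M 1 ⊓ imSub p k M (l + 1 - 1)) inf_le_left
    (le_inf le_rfl h)
  exact ⟨(asIso (sheafFπ p k M (l + 1))).symm ≪≫ asIso (Subobject.ofLE _ _ inf_le_left), by simp⟩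

end Sheaf
end SlTwo

end

theorem mainTheorem3 (k : Type u) [Field k] [IsAlgClosed k] (p : ℕ) [Fact p.Prime] [CharP k p]
    (l : ℕ) (hl : l < p) :
    (∀ i : ℕ, 1 ≤ i → i ≤ p → i ≠ l + 1 →
      CategoryTheory.Limits.IsZero (SlTwo.sheafF p k (SlTwo.WeylModule k l) i)) ∧
    (∃ φ : SlTwo.sheafF p k (SlTwo.WeylModule k l) (l + 1) ≅
        (SlTwo.kerSub p k (SlTwo.WeylModule k l) 1 : (SlTwo.ProjNullcone p k).Modules),
      SlTwo.sheafFπ p k (SlTwo.WeylModule k l) (l + 1) ≫ φ.hom =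
        CategoryTheory.Subobject.ofLE _ _ inf_le_left) ∧
    (∀ (m n : ℤ) (h : m + (l + 1 : ℕ) = n),
      SlTwo.globalOpPow p k (SlTwo.WeylModule k l) (l + 1) m n h = 0) ∧
    SlTwo.matB k l ^ (l + 1) = 0 ∧
    Module.Finite k
      (↥(LinearMap.ker (SlTwo.matB k l).mulVecLin) ⧸
        (LinearMap.range (SlTwo.matB k l ^ l).mulVecLin).submoduleOf
          (LinearMap.ker (SlTwo.matB k l).mulVecLin)) := by
  have hp : p ≠ 0 := (Fact.out : p.Prime).ne_zero
  have hunit : ∀ i : ℕ, i < l → (l : k) - i ≠ 0 := by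
    intro i hi h0
    rw [← Nat.cast_sub hi.le, CharP.cast_eq_zero_iff k p] at h0
    -- `0 < l - i < p`, so `p` does not divide `l - i`.
    exact absurd (Nat.le_of_dvd (Nat.sub_pos_of_lt hi) h0) (by omega)
  have hker := SlTwo.kerSub_one_le_imSub p k l hp hunit
  have him : SlTwo.imSub p k (SlTwo.WeylModule k l) (l + 1) = ⊥ := by
    simp only [SlTwo.imSub, SlTwo.globalOpPow_succ_eq_zero p k l hp, Limits.imageSubobject_zero]
  refine ⟨fun i hi _ hil => ?_, SlTwo.exists_iso_kerSub p k _ hker him,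
    fun m n h => SlTwo.globalOpPow_succ_eq_zero p k l hp h, SlTwo.matB_pow_eq_zero k l,
    SlTwo.finite_ker_matB_quotient k l hunit⟩
  rcases lt_or_gt_of_ne hil with h | h
  · exact SlTwo.isZero_sheafF_of_le p k _
      (hker.trans (SlTwo.imSub_antitone p k _ (Nat.le_of_lt_succ h)))
  · exact SlTwo.isZero_sheafF_of_eq_bot p k _
      (le_bot_iff.mp (him ▸ SlTwo.imSub_antitone p k _ (by omega : l + 1 ≤ i - 1)))
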